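/- All manifolds are finite dimensional, Hausdorff, second countable, without boundary, and all objects are smooth ($C^\infty$). **Setting.** A *discrete tangent bundle* of a manifold $\mathcal Q$ is a manifold $\mathcal V$ with $\dim\mathcal V=2\dim\mathcal Q$ together with submersions $\partial^+,\partial^-\colon\mathcal V\to\mathcal Q$ such that $\ker T\partial^+\cap\ker T\partial^-=0$ and such that for every $q\in\mathcal Q$ there is exactly one $v\in\mathcal V$ with $\partial^+(v)=\partial^-(v)=q$. Then $T_v\mathcal V=\ker T_v\partial^-\oplus\ker T_v\partial^+$; write $\delta v=\delta v^++\delta v^-$ for the corresponding decomposition, $\delta v^+\in\ker T_v\partial^-$, $\delta v^-\in\ker T_v\partial^+$. A *discrete constrained Lagrangian system* (DCLS) $(\mathcal V,\partial^+,\partial^-,\sigma_d,\mathcal D_d,\mathcal E_d)$ consists of a discrete tangent bundle of $\mathcal Q$, a one form $\sigma_d$ on $\mathcal V$, an (embedded) submanifold $\mathcal D_d\subseteq\mathcal V$ such that $\partial^+|\mathcal D_d$ and $\partial^-|\mathcal D_d$ are submersions, and a smooth subbundle $\mathcal E_d$ of the pull-back bundle $(\partial^+|\mathcal D_d)^*(T\mathcal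 Q)$. A pair $v,\tilde v\in\mathcal D_d$ is a *solution pair* if $\partial^+(v)=\partial^-(\tilde v)$ and $\sigma_d(v)\,\delta v+\sigma_d(\tilde v)\,\delta\tilde v=0$ for all $\delta v\in T_v\mathcal V$, $\delta\tilde v\in T_{\tilde v}\mathcal V$ with $T\partial^+(\delta v)=T\partial^-(\delta\tilde v)\in(\mathcal E_d)_v$, $T\partial^-(\delta v)=0$ and $T\partial^+(\delta\tilde v)=0$. An *evolution map* is a smooth map $F\colon U_F\to V_F$, with $U_F$ an open subset of $\mathcal D_d$ and $V_F\subseteq\mathcal D_d$, such that $(v,F(v))$ is a solution pair for all $v\in U_F$. Set $\theta^+(v)\,\delta v=\sigma_d(v)\,\delta v^+$, $\theta^-(v)\,\delta v=-\sigma_d(v)\,\delta v^-$, $\omega^\pm=-d\theta^\pm$. The DCLS is *holonomic*, with constraint distribution $\mathcal D_d^{\mathcal Q}$, if $d\sigma_d=0$ and $\mathcal D_d^{\mathcal Q}$ is an involutive smooth distribution (subbundle of $T\mathcal Q$) such that $(\mathcal E_d)_v=(\mathcal D_d^{\mathcal Q})_{\partial^+(v)}$ for all $v\in\mathcal D_d$;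 for all $v\in\mathcal D_d$ the points $\partial^-(v)$ and $\partial^+(v)$ are joined by a piecewise smooth curve with derivative in $\mathcal D_d^{\mathcal Q}$; and $\dim\mathcal D_d=\dim\mathcal D_d^{\mathcal Q}$, i.e. $\dim\mathcal D_d$ is $\dim\mathcal Q$ plus the fiber dimension of $\mathcal D_d^{\mathcal Q}$. For $v\in\mathcal D_d$ put $$(\mathcal K^0_{\mathcal D_d})_v=\{\delta v\in T_v\mathcal V : T\partial^-(\delta v)\in(\mathcal D_d^{\mathcal Q})_{\partial^-(v)},\ T\partial^+(\delta v)\in(\mathcal D_d^{\mathcal Q})_{\partial^+(v)}\}.$$ **Corollary.** Let $F\colon U_F\to V_F$ be an evolution map of a holonomic DCLS. Then $\omega^+=\omega^-$; denote the common value by $\omega_d$. Moreover $(\mathcal K^0_{\mathcal D_d})_v\subseteq T_v\mathcal D_d$ for all $v\in\mathcal D_d$, and $F$ is symplectic on $\mathcal K^0_{\mathcal D_d}$, i.e. for all $v\in U_F$ and all $\delta v,\delta w\in(\mathcal K^0_{\mathcal D_d})_v$, $$TF(\delta v)\in(\mathcal K^0_{\mathcal D_d})_{F(v)}\quad\text{and}\quad\omega_d(F(v))\bigl(TF(\delta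 v),TF(\delta w)\bigr)=\omega_d(v)(\delta v,\delta w).$$ -/

import Mathlib

open scoped Manifold ContDiff Topology

noncomputable section

namespace DiscreteMechanics

/-! Conventions: manifolds are smooth, without boundary, modelled on a finite dimensional real normed
space `E` through `𝓘(ℝ, E)`; the dimension of the manifold is `Module.finrank ℝ E`. -/

section Manifolds

variable {E : Type*} [NormedAddCommGroup E] [NormedSpace ℝ E]
  {M : Type*} [TopologicalSpace M] [ChartedSpace E M] [IsManifold 𝓘(ℝ, E) ∞ M]
  {E' : Type*} [NormedAddCommGroup E'] [NormedSpace ℝ E']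
  {N : Type*} [TopologicalSpace N] [ChartedSpace E' N] [IsManifold 𝓘(ℝ, E') ∞ N]

/-- The one form `θ` on `M` is smooth: it is a smooth section of the cotangent bundle. -/
def IsSmoothOneForm (θ : ∀ m : M, TangentSpace 𝓘(ℝ, E) m →L[ℝ] ℝ) : Prop :=
  ContMDiff 𝓘(ℝ, E) (𝓘(ℝ, E).prod 𝓘(ℝ, E →L[ℝ] ℝ)) ∞
    (fun m ↦ Bundle.TotalSpace.mk' (E →L[ℝ] ℝ)
      (E := fun m : M ↦ TangentSpace 𝓘(ℝ, E) m →L[ℝ] ℝ) m (θ m))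

/-- The local representative of the one form `θ` in the preferred chart at `m₀`: the pull-back of
`θ` by the inverse of the chart, a one form on the model space. -/
def oneFormInChart (θ : ∀ m : M, TangentSpace 𝓘(ℝ, E) m →L[ℝ] ℝ) (m₀ : M) (x : E) : E →L[ℝ] ℝ :=
  (θ ((extChartAt 𝓘(ℝ, E) m₀).symm x)).comp
    (mfderiv 𝓘(ℝ, E) 𝓘(ℝ, E) (extChartAt 𝓘(ℝ, E) m₀).symm x)

/-- The exterior derivative `dθ(m)(a, b)` of a (smooth) one form, computed in the preferred chart at
`m`, where it is `Dθ(x)(a)(b) - Dθ(x)(b)(a)`. The normalization is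
`dθ(X, Y) = X(θ(Y)) - Y(θ(X)) - θ([X, Y])`. -/
def dOneForm (θ : ∀ m : M, TangentSpace 𝓘(ℝ, E) m →L[ℝ] ℝ) (m : M)
    (a b : TangentSpace 𝓘(ℝ, E) m) : ℝ :=
  let a' : E := mfderiv 𝓘(ℝ, E) 𝓘(ℝ, E) (extChartAt 𝓘(ℝ, E) m) m a
  let b' : E := mfderiv 𝓘(ℝ, E) 𝓘(ℝ, E) (extChartAt 𝓘(ℝ, E) m) m b
  let Dθ : E →L[ℝ] E →L[ℝ] ℝ := fderiv ℝ (oneFormInChart θ m) (extChartAt 𝓘(ℝ, E) m m)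
  Dθ a' b' - Dθ b' a'

/-- `A` is a smooth subbundle of the pull-back bundle `f^*(TN)`, i.e. a smooth assignment of
subspaces `A x ⊆ T_{f(x)}N` to the points `x` of `M`: near every point of `M` it is spanned by a
smooth frame. -/
def IsSubbundleAlong (f : M → N) (A : ∀ x : M, Submodule ℝ (TangentSpace 𝓘(ℝ, E') (f x))) : Prop :=
  ∀ x₀ : M, ∃ (k : ℕ) (u : Set M) (X : Fin k → ∀ x : M, TangentSpace 𝓘(ℝ, E') (f x)),
    IsOpen u ∧ x₀ ∈ u ∧
    (∀ i, ContMDiffOn 𝓘(ℝ, E) 𝓘(ℝ, E').tangent ∞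
      (fun x ↦ (⟨f x, X i x⟩ : TangentBundle 𝓘(ℝ, E') N)) u) ∧
    ∀ x ∈ u, LinearIndependent ℝ (fun i ↦ X i x) ∧
      Submodule.span ℝ (Set.range fun i ↦ X i x) = A x

/-- A smooth distribution on `M`, i.e. a smooth subbundle of `TM`. -/
def IsDistribution (Δ : ∀ m : M, Submodule ℝ (TangentSpace 𝓘(ℝ, E) m)) : Prop :=
  IsSubbundleAlong (E := E) (E' := E) (fun m : M ↦ m) Δ

/-- The distribution `Δ` is involutive: the Lie bracket of any two smooth (local) vector fields with
values in `Δ` has values in `Δ`. -/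
def IsInvolutive (Δ : ∀ m : M, Submodule ℝ (TangentSpace 𝓘(ℝ, E) m)) : Prop :=
  ∀ (u : Set M) (X Y : ∀ m : M, TangentSpace 𝓘(ℝ, E) m), IsOpen u →
    ContMDiffOn 𝓘(ℝ, E) 𝓘(ℝ, E).tangent ∞ (fun m ↦ (⟨m, X m⟩ : TangentBundle 𝓘(ℝ, E) M)) u →
    ContMDiffOn 𝓘(ℝ, E) 𝓘(ℝ, E).tangent ∞ (fun m ↦ (⟨m, Y m⟩ : TangentBundle 𝓘(ℝ, E) M)) u →
    (∀ m ∈ u, X m ∈ Δ m) → (∀ m ∈ u, Y m ∈ Δ m) →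
    ∀ m ∈ u, VectorField.mlieBracket 𝓘(ℝ, E) X Y m ∈ Δ m

/-- `m'` is `Δ`-reachable from `m`: there are a curve `c` on `[a, b]` from `m` to `m'` and a
partition `a = t 0 < t 1 < ⋯ < t n = b` such that, on every `[t i, t (i + 1)]`, the curve is smooth
with derivative in `Δ`. -/
def Reachable (Δ : ∀ m : M, Submodule ℝ (TangentSpace 𝓘(ℝ, E) m)) (m m' : M) : Prop :=
  ∃ (c : ℝ → M) (n : ℕ) (t : ℕ → ℝ), c (t 0) = m ∧ c (t n) = m' ∧
    ∀ i < n, t i < t (i + 1) ∧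
      ContMDiffOn 𝓘(ℝ, ℝ) 𝓘(ℝ, E) ∞ c (Set.Icc (t i) (t (i + 1))) ∧
      ∀ s ∈ Set.Icc (t i) (t (i + 1)),
        mfderivWithin 𝓘(ℝ, ℝ) 𝓘(ℝ, E) c (Set.Icc (t i) (t (i + 1))) s (1 : ℝ) ∈ Δ (c s)

end Manifolds

section Systems

variable (EQ : Type*) [NormedAddCommGroup EQ] [NormedSpace ℝ EQ]
  (Q : Type*) [TopologicalSpace Q] [ChartedSpace EQ Q] [IsManifold 𝓘(ℝ, EQ) ∞ Q]
  (EV : Type*) [NormedAddCommGroup EV] [NormedSpace ℝ EV]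
  (V : Type*) [TopologicalSpace V] [ChartedSpace EV V] [IsManifold 𝓘(ℝ, EV) ∞ V]
  (ED : Type*) [NormedAddCommGroup ED] [NormedSpace ℝ ED]
  (D : Type*) [TopologicalSpace D] [ChartedSpace ED D] [IsManifold 𝓘(ℝ, ED) ∞ D]

/-- A discrete tangent bundle `(V, ∂⁺, ∂⁻)` of `Q`. -/
structure DiscreteTangentBundle where
  /-- the boundary map `∂⁺` -/
  bdPlus : V → Q
  /-- the boundary map `∂⁻` -/
  bdMinus : V → Q
  finrank_eq : Module.finrank ℝ EV = 2 * Module.finrank ℝ EQ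
  contMDiff_bdPlus : ContMDiff 𝓘(ℝ, EV) 𝓘(ℝ, EQ) ∞ bdPlus
  contMDiff_bdMinus : ContMDiff 𝓘(ℝ, EV) 𝓘(ℝ, EQ) ∞ bdMinus
  surjective_bdPlus : ∀ v, Function.Surjective (mfderiv 𝓘(ℝ, EV) 𝓘(ℝ, EQ) bdPlus v)
  surjective_bdMinus : ∀ v, Function.Surjective (mfderiv 𝓘(ℝ, EV) 𝓘(ℝ, EQ) bdMinus v)
  ker_inf_ker : ∀ v, (mfderiv 𝓘(ℝ, EV) 𝓘(ℝ, EQ) bdPlus v).ker ⊓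
    (mfderiv 𝓘(ℝ, EV) 𝓘(ℝ, EQ) bdMinus v).ker = ⊥
  existsUnique_zero : ∀ q, ∃! v, bdPlus v = q ∧ bdMinus v = q

/-- A discrete constrained Lagrangian system `(V, ∂⁺, ∂⁻, σ, D, A)` on `Q`. The constraint
submanifold is a manifold `D` with a smooth embedding `incl : D → V`, and `A` is the subbundle of
`(∂⁺|D)^*(TQ)` of admissible variations. -/
structure DCLS extends DiscreteTangentBundle EQ Q EV V where
  /-- the discrete Lagrangian one form `σ` on `V` -/
  sigma : ∀ v : V, TangentSpace 𝓘(ℝ, EV) v →L[ℝ] ℝ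
  smooth_sigma : IsSmoothOneForm sigma
  /-- the inclusion of the constraint submanifold -/
  incl : D → V
  contMDiff_incl : ContMDiff 𝓘(ℝ, ED) 𝓘(ℝ, EV) ∞ incl
  injective_incl : ∀ x, Function.Injective (mfderiv 𝓘(ℝ, ED) 𝓘(ℝ, EV) incl x)
  isEmbedding_incl : Topology.IsEmbedding incl
  surjective_bdPlus_incl : ∀ x,
    Function.Surjective (mfderiv 𝓘(ℝ, ED) 𝓘(ℝ, EQ) (bdPlus ∘ incl) x)
  surjective_bdMinus_incl : ∀ x,
    Function.Surjective (mfderiv 𝓘(ℝ, ED) 𝓘(ℝ, EQ) (bdMinus ∘ incl) x)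
  /-- the subspaces `A x ⊆ T_{∂⁺(x)}Q`, `x ∈ D`, of the variations -/
  variations : ∀ x : D, Submodule ℝ (TangentSpace 𝓘(ℝ, EQ) (bdPlus (incl x)))
  isSubbundle_variations :
    IsSubbundleAlong (E := ED) (E' := EQ) (fun x ↦ bdPlus (incl x)) variations

end Systems

variable {EQ : Type*} [NormedAddCommGroup EQ] [NormedSpace ℝ EQ] [FiniteDimensional ℝ EQ]
  {Q : Type*} [TopologicalSpace Q] [ChartedSpace EQ Q] [IsManifold 𝓘(ℝ, EQ) ∞ Q]
  {EV : Type*} [NormedAddCommGroup EV] [NormedSpace ℝ EV] [FiniteDimensional ℝ EV]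
  {V : Type*} [TopologicalSpace V] [ChartedSpace EV V] [IsManifold 𝓘(ℝ, EV) ∞ V]
  {ED : Type*} [NormedAddCommGroup ED] [NormedSpace ℝ ED]
  {D : Type*} [TopologicalSpace D] [ChartedSpace ED D] [IsManifold 𝓘(ℝ, ED) ∞ D]

namespace DiscreteTangentBundle

/-- `T_v∂⁺` -/
abbrev tPlus (B : DiscreteTangentBundle EQ Q EV V) (v : V) :
    TangentSpace 𝓘(ℝ, EV) v →L[ℝ] TangentSpace 𝓘(ℝ, EQ) (B.bdPlus v) :=
  mfderiv 𝓘(ℝ, EV) 𝓘(ℝ, EQ) B.bdPlus v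

/-- `T_v∂⁻` -/
abbrev tMinus (B : DiscreteTangentBundle EQ Q EV V) (v : V) :
    TangentSpace 𝓘(ℝ, EV) v →L[ℝ] TangentSpace 𝓘(ℝ, EQ) (B.bdMinus v) :=
  mfderiv 𝓘(ℝ, EV) 𝓘(ℝ, EQ) B.bdMinus v

/-- `T_vV = ker T_v∂⁻ ⊕ ker T_v∂⁺` -/
theorem isCompl_ker (B : DiscreteTangentBundle EQ Q EV V) (v : V) :
    IsCompl (B.tMinus v).ker (B.tPlus v).ker := by
  have key : ∀ f g : EV →ₗ[ℝ] EQ, Function.Surjective f → Function.Surjective g →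
      LinearMap.ker f ⊓ LinearMap.ker g = ⊥ → IsCompl (LinearMap.ker g) (LinearMap.ker f) := by
    intro f g hf hg h
    have h1 := LinearMap.finrank_range_add_finrank_ker f
    have h2 := LinearMap.finrank_range_add_finrank_ker g
    rw [LinearMap.range_eq_top.2 hf, finrank_top] at h1
    rw [LinearMap.range_eq_top.2 hg, finrank_top] at h2
    have h3 := B.finrank_eq
    exact (Submodule.isCompl_iff_disjoint (LinearMap.ker g) (LinearMap.ker f) (by omega)).2
      (disjoint_iff.2 ((inf_comm (LinearMap.ker g) (LinearMap.ker f)).trans h))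
  exact key _ _ (B.surjective_bdPlus v) (B.surjective_bdMinus v) (B.ker_inf_ker v)

/-- The part `δv⁺ ∈ ker T∂⁻` of `δv = δv⁺ + δv⁻`, as a linear map of `δv`. -/
def plusPart (B : DiscreteTangentBundle EQ Q EV V) (v : V) :
    TangentSpace 𝓘(ℝ, EV) v →ₗ[ℝ] TangentSpace 𝓘(ℝ, EV) v :=
  (B.tMinus v).ker.projection (B.tPlus v).ker (B.isCompl_ker v)

/-- The part `δv⁻ ∈ ker T∂⁺` of `δv = δv⁺ + δv⁻`, as a linear map of `δv`. -/
def minusPart (B : DiscreteTangentBundle EQ Q EV V) (v : V) :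
    TangentSpace 𝓘(ℝ, EV) v →ₗ[ℝ] TangentSpace 𝓘(ℝ, EV) v :=
  (B.tPlus v).ker.projection (B.tMinus v).ker (B.isCompl_ker v).symm

end DiscreteTangentBundle

namespace DCLS

/-- The one form `θ⁺(v)(δv) = σ(v)(δv⁺)` on `V`. -/
def thetaPlus (S : DCLS EQ Q EV V ED D) (v : V) : TangentSpace 𝓘(ℝ, EV) v →L[ℝ] ℝ :=
  haveI : FiniteDimensional ℝ (TangentSpace 𝓘(ℝ, EV) v) := inferInstanceAs (FiniteDimensional ℝ EV)
  haveI : T2Space (TangentSpace 𝓘(ℝ, EV) v) := inferInstanceAs (T2Space EV)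
  LinearMap.toContinuousLinearMap ((S.sigma v).toLinearMap ∘ₗ S.plusPart v)

/-- The one form `θ⁻(v)(δv) = -σ(v)(δv⁻)` on `V`. -/
def thetaMinus (S : DCLS EQ Q EV V ED D) (v : V) : TangentSpace 𝓘(ℝ, EV) v →L[ℝ] ℝ :=
  haveI : FiniteDimensional ℝ (TangentSpace 𝓘(ℝ, EV) v) := inferInstanceAs (FiniteDimensional ℝ EV)
  haveI : T2Space (TangentSpace 𝓘(ℝ, EV) v) := inferInstanceAs (T2Space EV)
  LinearMap.toContinuousLinearMap (-((S.sigma v).toLinearMap ∘ₗ S.minusPart v))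

/-- The two form `ω⁺ = -dθ⁺` on `V`. -/
def omegaPlus (S : DCLS EQ Q EV V ED D) (v : V) (δv δw : TangentSpace 𝓘(ℝ, EV) v) : ℝ :=
  -dOneForm S.thetaPlus v δv δw

/-- The two form `ω⁻ = -dθ⁻` on `V`. -/
def omegaMinus (S : DCLS EQ Q EV V ED D) (v : V) (δv δw : TangentSpace 𝓘(ℝ, EV) v) : ℝ :=
  -dOneForm S.thetaMinus v δv δw

/-- `(x, y)` is a solution pair: it satisfies the discrete Lagrange-d'Alembert principle for
sequences of length two. -/
def IsSolutionPair (S : DCLS EQ Q EV V ED D) (x y : D) : Prop :=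
  S.bdPlus (S.incl x) = S.bdMinus (S.incl y) ∧
  ∀ (δv : TangentSpace 𝓘(ℝ, EV) (S.incl x)) (δw : TangentSpace 𝓘(ℝ, EV) (S.incl y)),
    S.tPlus (S.incl x) δv ∈ S.variations x →
    S.tMinus (S.incl x) δv = 0 → S.tPlus (S.incl y) δw = 0 →
    (⟨S.bdPlus (S.incl x), S.tPlus (S.incl x) δv⟩ : TangentBundle 𝓘(ℝ, EQ) Q) =
      ⟨S.bdMinus (S.incl y), S.tMinus (S.incl y) δw⟩ →
    S.sigma (S.incl x) δv + S.sigma (S.incl y) δw = 0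

/-- `F : U → U'` is an evolution map of the system: it is a smooth map, with open domain `U`, of the
constraint submanifold, and `(x, F x)` is a solution pair for all `x ∈ U`. -/
structure IsEvolutionMap (S : DCLS EQ Q EV V ED D) (F : D → D) (U U' : Set D) : Prop where
  isOpen_dom : IsOpen U
  mapsTo : Set.MapsTo F U U'
  contMDiffOn : ContMDiffOn 𝓘(ℝ, ED) 𝓘(ℝ, ED) ∞ F U
  isSolutionPair : ∀ x ∈ U, S.IsSolutionPair x (F x)

/-- The system has linear constraints, provided by the distribution `Δ` on `Q`. The last condition
is `dim D = dim Δ`, where `Δ` is regarded as a submanifold of `TQ`. -/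
structure HasLinearConstraints (S : DCLS EQ Q EV V ED D)
    (Δ : ∀ q : Q, Submodule ℝ (TangentSpace 𝓘(ℝ, EQ) q)) : Prop where
  isDistribution : IsDistribution Δ
  variations_eq : ∀ x, S.variations x = Δ (S.bdPlus (S.incl x))
  reachable : ∀ x, Reachable Δ (S.bdMinus (S.incl x)) (S.bdPlus (S.incl x))
  finrank_eq : ∀ q, Module.finrank ℝ ED = Module.finrank ℝ EQ + Module.finrank ℝ (Δ q)

/-- The system is holonomic, with constraint distribution `Δ`. -/
structure IsHolonomic (S : DCLS EQ Q EV V ED D)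
    (Δ : ∀ q : Q, Submodule ℝ (TangentSpace 𝓘(ℝ, EQ) q)) : Prop
    extends S.HasLinearConstraints Δ where
  isInvolutive : IsInvolutive Δ
  closed_sigma : ∀ v δv δw, dOneForm S.sigma v δv δw = 0

/-- The distribution `K⁰ = ((T∂⁻)⁻¹Δ ∩ (T∂⁺)⁻¹Δ)|D`, made of tangent vectors of `V` at points
of `D`. -/
def K0 (S : DCLS EQ Q EV V ED D) (Δ : ∀ q : Q, Submodule ℝ (TangentSpace 𝓘(ℝ, EQ) q)) (x : D) :
    Submodule ℝ (TangentSpace 𝓘(ℝ, EV) (S.incl x)) :=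
  (Δ (S.bdMinus (S.incl x))).comap (S.tMinus (S.incl x)).toLinearMap ⊓
    (Δ (S.bdPlus (S.incl x))).comap (S.tPlus (S.incl x)).toLinearMap

/-- The tangent map of the inclusion of the constraint submanifold. -/
abbrev tIncl (S : DCLS EQ Q EV V ED D) (x : D) :
    TangentSpace 𝓘(ℝ, ED) x →L[ℝ] TangentSpace 𝓘(ℝ, EV) (S.incl x) :=
  mfderiv 𝓘(ℝ, ED) 𝓘(ℝ, EV) S.incl x

end DCLS

end DiscreteMechanics

end

/-! Near every point, an involutive distribution `Δ` has a frame normalized by a linear map, and the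
fields of such a frame commute. Their flows provide a label of the local leaves, and a curve is
tangent to `Δ` if and only if the label is constant along it. Since `Q` is second countable, a leaf
meets only countably many local leaves of a chart, so every continuous curve that stays in one leaf
has constant label, that is, is tangent to `Δ`. On `D`, the points `∂⁻` and `∂⁺` lie in the same
leaf: hence, for `w ∈ TD`, `T∂⁻w ∈ Δ` implies `T∂⁺w ∈ Δ`, and counting dimensions gives `K⁰ ⊆ TD`.
The same implication at `F(v)`, where `T∂⁻(TF w) = T∂⁺w`, makes `K⁰` invariant.

By the Lagrange-d'Alembert principle, `θ⁺` and `F^*θ⁻` agree on the vectors of `TD` in `(T∂⁺)⁻¹Δ`.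
These form an involutive distribution, so the exterior derivatives of the two forms agree on it as
well. Finally `ω⁺ = ω⁻`, since `θ⁺ - θ⁻ = σ` is closed. -/

noncomputable section

namespace DiscreteMechanics

/-! ### Flows of bounded Lipschitz families of vector fields -/

section Flows

open Metric Set
open scoped NNReal

variable {E₁ E : Type*} [NormedAddCommGroup E₁] [NormedSpace ℝ E₁]
  [NormedAddCommGroup E] [NormedSpace ℝ E]

/-- A bounded and globally Lipschitz family `N(·)v` of vector fields on `E`, linear in the parameter
`v`. The two bounds make the flows complete. -/
structure IsBoundedLipschitz (N : E → E₁ →L[ℝ] E) (M K : ℝ≥0) : Prop where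
  norm_le : ∀ y, ‖N y‖ ≤ M
  lipschitz : LipschitzWith K N

namespace IsBoundedLipschitz

variable {N : E → E₁ →L[ℝ] E} {M K : ℝ≥0}

theorem norm_apply_le (hN : IsBoundedLipschitz N M K) (y : E) (v : E₁) : ‖N y v‖ ≤ M * ‖v‖ :=
  (N y).le_of_opNorm_le (hN.norm_le y) v

theorem lipschitzWith_apply (hN : IsBoundedLipschitz N M K) (v : E₁) :
    LipschitzWith (K * ‖v‖₊) fun y ↦ N y v := by
  refine LipschitzWith.of_dist_le_mul fun x y ↦ ?_
  calc dist (N x v) (N y v) = ‖(N x - N y) v‖ := by rw [dist_eq_norm, sub_apply]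
    _ ≤ (K * dist x y) * ‖v‖ :=
      (N x - N y).le_of_opNorm_le (dist_eq_norm (N x) (N y) ▸ hN.lipschitz.dist_le_mul x y) v
    _ = (K * ‖v‖₊ : ℝ≥0) * dist x y := by push_cast; ring

variable [CompleteSpace E]

theorem exists_integralCurve (hN : IsBoundedLipschitz N M K) (v : E₁) (z : E) :
    ∃ ψ : ℝ → E, ψ 0 = z ∧ ∀ t ∈ Icc (0 : ℝ) 1, HasDerivAt ψ (N (ψ t) v) t := by
  have h : IsPicardLindelof (fun _ y ↦ N y v) (tmin := -1) (tmax := 2) ⟨0, by norm_num⟩ z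
      (M * ‖v‖₊ * 2) 0 (M * ‖v‖₊) (K * ‖v‖₊) := by
    refine IsPicardLindelof.of_time_independent (fun x _ ↦ hN.norm_apply_le x v)
      (hN.lipschitzWith_apply v).lipschitzOnWith ?_
    norm_num
  obtain ⟨ψ, h0, h1⟩ := h.exists_eq_forall_mem_Icc_hasDerivWithinAt₀
  exact ⟨ψ, h0, fun t ht ↦ (h1 t ⟨by linarith [ht.1], by linarith [ht.2]⟩).hasDerivAt
    (Icc_mem_nhds (by linarith [ht.1]) (by linarith [ht.2]))⟩

/-- The integral curve of `N(·)v` that starts at `z`; it is only meaningful on `[0, 1]`. -/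
def flow (hN : IsBoundedLipschitz N M K) (v : E₁) (z : E) : ℝ → E :=
  (hN.exists_integralCurve v z).choose

/-- The time one map of the flow of `N(·)v`. -/
def exp (hN : IsBoundedLipschitz N M K) (v : E₁) (z : E) : E := hN.flow v z 1

variable (hN : IsBoundedLipschitz N M K)
include hN

@[simp]
theorem flow_zero (v : E₁) (z : E) : hN.flow v z 0 = z :=
  (hN.exists_integralCurve v z).choose_spec.1

theorem hasDerivAt_flow (v : E₁) (z : E) {t : ℝ} (ht : t ∈ Icc (0 : ℝ) 1) :
    HasDerivAt (hN.flow v z) (N (hN.flow v z t) v) t :=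
  (hN.exists_integralCurve v z).choose_spec.2 t ht

theorem continuousOn_flow (v : E₁) (z : E) : ContinuousOn (hN.flow v z) (Icc 0 1) :=
  fun _ ht ↦ (hN.hasDerivAt_flow v z ht).continuousAt.continuousWithinAt

theorem hasDerivWithinAt_flow (v : E₁) (z : E) :
    ∀ t ∈ Ico (0 : ℝ) 1, HasDerivWithinAt (hN.flow v z) (N (hN.flow v z t) v) (Ici t) t :=
  fun _ ht ↦ (hN.hasDerivAt_flow v z (Ico_subset_Icc_self ht)).hasDerivWithinAt

theorem dist_flow_le (v : E₁) (z : E) {t : ℝ} (ht : t ∈ Icc (0 : ℝ) 1) :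
    dist (hN.flow v z t) z ≤ M * ‖v‖ := by
  have h := norm_image_sub_le_of_norm_deriv_le_segment' (f := hN.flow v z) (a := 0) (b := 1)
    (fun x hx ↦ (hN.hasDerivAt_flow v z hx).hasDerivWithinAt)
    (fun x _ ↦ hN.norm_apply_le (hN.flow v z x) v) t ht
  rw [hN.flow_zero, sub_zero, ← dist_eq_norm] at h
  exact h.trans (mul_le_of_le_one_right (by positivity) ht.2)

theorem dist_exp_le (v : E₁) (z : E) : dist (hN.exp v z) z ≤ M * ‖v‖ :=
  hN.dist_flow_le v z (right_mem_Icc.2 zero_le_one)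

theorem dist_exp_exp_le (v : E₁) (z z' : E) :
    dist (hN.exp v z) (hN.exp v z') ≤ dist z z' * Real.exp (K * ‖v‖) := by
  have h := dist_le_of_trajectories_ODE (v := fun _ y ↦ N y v) (δ := dist z z')
    (fun _ ↦ hN.lipschitzWith_apply v) (hN.continuousOn_flow v z) (hN.hasDerivWithinAt_flow v z)
    (hN.continuousOn_flow v z') (hN.hasDerivWithinAt_flow v z')
    (by rw [hN.flow_zero, hN.flow_zero]) 1 (right_mem_Icc.2 zero_le_one)
  simpa [exp] using h

theorem exp_neg_exp (v : E₁) (z : E) : hN.exp (-v) (hN.exp v z) = z := by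
  have hasDerivAt_reversed : ∀ t ∈ Icc (0 : ℝ) 1, HasDerivAt (fun t ↦ hN.flow v z (1 - t))
      (N (hN.flow v z (1 - t)) (-v)) t := fun t ht ↦ by
    have h := (hN.hasDerivAt_flow v z (t := 1 - t) ⟨by linarith [ht.2], by linarith [ht.1]⟩).scomp t
      ((hasDerivAt_id t).const_sub 1)
    rwa [neg_one_smul, ← map_neg] at h
  have h := ODE_solution_unique (v := fun _ y ↦ N y (-v)) (g := fun t ↦ hN.flow v z (1 - t))
    (fun _ ↦ hN.lipschitzWith_apply (-v)) (hN.continuousOn_flow (-v) (hN.exp v z))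
    (hN.hasDerivWithinAt_flow (-v) (hN.exp v z))
    (fun t ht ↦ (hasDerivAt_reversed t ht).continuousAt.continuousWithinAt)
    (fun t ht ↦ (hasDerivAt_reversed t (Ico_subset_Icc_self ht)).hasDerivWithinAt)
    (by simp [exp])
  simpa [exp] using h (right_mem_Icc.2 zero_le_one)

theorem exp_exp_neg (v : E₁) (z : E) : hN.exp v (hN.exp (-v) z) = z := by
  simpa using hN.exp_neg_exp (-v) z

/-- The first order approximation, in `h`, of the integral curve of `N(·)(v + h)` that starts at
`z`, under the assumption that the fields `N(·)a` commute. -/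
def variation (hN : IsBoundedLipschitz N M K) (v h : E₁) (z : E) (t : ℝ) : E :=
  hN.flow v z t + t • N (hN.flow v z t) h

theorem hasDerivAt_variation (hd : Differentiable ℝ N) (v h : E₁) (z : E) {t : ℝ}
    (ht : t ∈ Icc (0 : ℝ) 1) :
    HasDerivAt (hN.variation v h z) (N (hN.flow v z t) v +
      (t • fderiv ℝ N (hN.flow v z t) (N (hN.flow v z t) v) h + N (hN.flow v z t) h)) t := by
  have hψ := hN.hasDerivAt_flow v z ht
  have hNψ := ((hd (hN.flow v z t)).hasFDerivAt.comp_hasDerivAt t hψ).clm_apply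
    (hasDerivAt_const t h)
  rw [map_zero, add_zero] at hNψ
  have hvariation := hψ.add ((hasDerivAt_id t).smul hNψ)
  rw [one_smul] at hvariation
  exact hvariation

end IsBoundedLipschitz

end Flows

/-! ### Commuting frames -/

section CommutingFrames

open Metric Set
open scoped NNReal

variable {E₁ E : Type*} [NormedAddCommGroup E₁] [NormedSpace ℝ E₁]
  [NormedAddCommGroup E] [NormedSpace ℝ E]

theorem norm_sub_fderiv_le_of_lipschitzWith_fderiv {f : E₁ → E} {C : ℝ≥0}
    (hf : Differentiable ℝ f) (hC : LipschitzWith C (fderiv ℝ f)) (x k : E₁) :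
    ‖f (x + k) - f x - fderiv ℝ f x k‖ ≤ C * ‖k‖ ^ 2 := by
  have h := (convex_closedBall x ‖k‖).norm_image_sub_le_of_norm_hasFDerivWithin_le'
    (f := f) (φ := fderiv ℝ f x) (C := C * ‖k‖) (x := x) (y := x + k)
    (fun y _ ↦ (hf y).hasFDerivAt.hasFDerivWithinAt) (fun y hy ↦ by
      rw [← dist_eq_norm]
      exact (hC.dist_le_mul y x).trans (by gcongr; exact hy)) (by simp) (by simp)
  rwa [add_sub_cancel_left, mul_assoc, ← sq] at h

/-- A bounded, globally Lipschitz family `N(·)a` of vector fields on `E` with Lipschitz derivative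
such that, on the ball of radius `ρ` around `y₀`, these fields commute and are mapped by `ℓ` to the
constant fields `a`. -/
structure CommutingFrame (N : E → E₁ →L[ℝ] E) (ℓ : E →L[ℝ] E₁) (y₀ : E) (ρ : ℝ)
    (M K C : ℝ≥0) : Prop extends IsBoundedLipschitz N M K where
  differentiable : Differentiable ℝ N
  lipschitz_fderiv : LipschitzWith C (fderiv ℝ N)
  radius_pos : 0 < ρ
  left_inv : ∀ y ∈ ball y₀ ρ, ∀ a, ℓ (N y a) = a
  comm : ∀ y ∈ ball y₀ ρ, ∀ a b, fderiv ℝ N y (N y a) b = fderiv ℝ N y (N y b) a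

namespace CommutingFrame

variable {N : E → E₁ →L[ℝ] E} {ℓ : E →L[ℝ] E₁} {y₀ : E} {ρ : ℝ} {M K C : ℝ≥0}
  (hN : CommutingFrame N ℓ y₀ ρ M K C)
include hN

theorem norm_defect_le {y : E} (hy : y ∈ ball y₀ ρ) (v : E₁) {h : E₁} (hh : ‖h‖ ≤ 1) {t : ℝ}
    (ht : t ∈ Icc (0 : ℝ) 1) :
    ‖N y v + (t • fderiv ℝ N y (N y v) h + N y h) - N (y + t • N y h) (v + h)‖ ≤
      (K * M + C * M ^ 2 * (‖v‖ + 1)) * ‖h‖ ^ 2 := by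
  set k := t • N y h with hk
  have norm_k_le : ‖k‖ ≤ M * ‖h‖ := by
    rw [hk, norm_smul, Real.norm_of_nonneg ht.1]
    exact (mul_le_of_le_one_left (norm_nonneg _) ht.2).trans (hN.norm_apply_le y h)
  have first_order : ‖fderiv ℝ N y k h‖ ≤ K * M * ‖h‖ ^ 2 :=
    calc ‖fderiv ℝ N y k h‖ ≤ ‖fderiv ℝ N y‖ * ‖k‖ * ‖h‖ := (fderiv ℝ N y).le_opNorm₂ k h
      _ ≤ K * (M * ‖h‖) * ‖h‖ := by gcongr; exact norm_fderiv_le_of_lipschitz ℝ hN.lipschitz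
      _ = K * M * ‖h‖ ^ 2 := by ring
  have second_order : ‖(N (y + k) - N y - fderiv ℝ N y k) (v + h)‖ ≤
      C * M ^ 2 * (‖v‖ + 1) * ‖h‖ ^ 2 :=
    calc ‖(N (y + k) - N y - fderiv ℝ N y k) (v + h)‖ ≤ C * ‖k‖ ^ 2 * ‖v + h‖ :=
          ContinuousLinearMap.le_of_opNorm_le _ (norm_sub_fderiv_le_of_lipschitzWith_fderiv
            hN.differentiable hN.lipschitz_fderiv y k) _
      _ ≤ C * (M * ‖h‖) ^ 2 * (‖v‖ + 1) := by
          gcongr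
          exact (norm_add_le v h).trans (by gcongr)
      _ = C * M ^ 2 * (‖v‖ + 1) * ‖h‖ ^ 2 := by ring
  have expansion : N y v + (t • fderiv ℝ N y (N y v) h + N y h) - N (y + k) (v + h) =
      -(fderiv ℝ N y k h) - (N (y + k) - N y - fderiv ℝ N y k) (v + h) := by
    simp only [hk, hN.comm y hy v h, map_add, map_smul, sub_apply, smul_apply]
    abel
  rw [expansion]
  refine (norm_sub_le _ _).trans ?_
  rw [norm_neg]
  linarith

variable [CompleteSpace E]

theorem flow_mem_ball {v : E₁} {z : E} (hz : z ∈ ball y₀ (ρ / 2)) (hv : M * ‖v‖ < ρ / 2) {t : ℝ}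
    (ht : t ∈ Icc (0 : ℝ) 1) : hN.flow v z t ∈ ball y₀ ρ := by
  rw [mem_ball] at hz ⊢
  linarith [hN.dist_flow_le v z ht, dist_triangle (hN.flow v z t) z y₀]

theorem exists_norm_exp_add_sub_le {v : E₁} {z : E} (hz : z ∈ ball y₀ (ρ / 2))
    (hv : M * ‖v‖ < ρ / 2) :
    ∃ B, ∀ h, ‖h‖ ≤ 1 →
      ‖hN.exp (v + h) z - hN.exp v z - N (hN.exp v z) h‖ ≤ B * ‖h‖ ^ 2 := by
  -- Adding `1` makes the Lipschitz constant nonzero, for the closed form of `gronwallBound`.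
  set L : ℝ≥0 := K * (‖v‖₊ + 1) + 1
  set A : ℝ := K * M + C * M ^ 2 * (‖v‖ + 1)
  refine ⟨A / L * (Real.exp L - 1), fun h hh ↦ ?_⟩
  have lipschitz_add : LipschitzWith L fun y ↦ N y (v + h) :=
    (hN.lipschitzWith_apply (v + h)).weaken <| by
      have : ‖v + h‖₊ ≤ ‖v‖₊ + 1 := (nnnorm_add_le v h).trans (by gcongr; exact hh)
      exact (mul_le_mul_right this K).trans le_self_add
  have hasDerivAt_variation : ∀ t ∈ Icc (0 : ℝ) 1, _ := fun t ht ↦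
    hN.hasDerivAt_variation hN.differentiable v h z (t := t) ht
  have gronwall := dist_le_of_approx_trajectories_ODE (v := fun _ y ↦ N y (v + h)) (δ := 0)
    (εf := A * ‖h‖ ^ 2) (εg := 0) (fun _ ↦ lipschitz_add)
    (fun t ht ↦ (hasDerivAt_variation t ht).continuousAt.continuousWithinAt)
    (fun t ht ↦ (hasDerivAt_variation t (Ico_subset_Icc_self ht)).hasDerivWithinAt)
    (fun t ht ↦ dist_eq_norm (E := E) _ _ ▸ hN.norm_defect_le
      (hN.flow_mem_ball hz hv (Ico_subset_Icc_self ht)) v hh (Ico_subset_Icc_self ht))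
    (hN.continuousOn_flow (v + h) z) (hN.hasDerivWithinAt_flow (v + h) z) (by simp)
    (by simp [IsBoundedLipschitz.variation]) 1 (right_mem_Icc.2 zero_le_one)
  calc ‖hN.exp (v + h) z - hN.exp v z - N (hN.exp v z) h‖
      = dist (hN.variation v h z 1) (hN.flow (v + h) z 1) := by
        rw [dist_comm, dist_eq_norm, IsBoundedLipschitz.variation, one_smul, sub_add_eq_sub_sub]
        rfl
    _ ≤ A / L * (Real.exp L - 1) * ‖h‖ ^ 2 := by
        rw [gronwallBound_of_K_ne_0 (by positivity)] at gronwall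
        refine gronwall.trans_eq ?_
        simp only [sub_zero, mul_one, zero_mul, add_zero, zero_add]
        ring

/-- The fields commute, so moving the parameter from `v` to `v + h` amounts to flowing along `h` for
unit time after flowing along `v`. -/
theorem hasFDerivAt_exp {v : E₁} {z : E} (hz : z ∈ ball y₀ (ρ / 2)) (hv : M * ‖v‖ < ρ / 2) :
    HasFDerivAt (fun v ↦ hN.exp v z) (N (hN.exp v z)) v := by
  obtain ⟨B, hB⟩ := hN.exists_norm_exp_add_sub_le hz hv
  have isBigO_sq : (fun h ↦ hN.exp (v + h) z - hN.exp v z - N (hN.exp v z) h) =O[𝓝 0]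
      fun h : E₁ ↦ ‖h‖ ^ 2 := by
    refine Asymptotics.IsBigO.of_bound B ?_
    filter_upwards [closedBall_mem_nhds (0 : E₁) one_pos] with h hh
    rw [norm_pow, norm_norm]
    exact hB h (mem_closedBall_zero_iff.1 hh)
  rw [hasFDerivAt_iff_isLittleO_nhds_zero]
  exact isBigO_sq.trans_isLittleO (by simpa using Asymptotics.isLittleO_norm_pow_id one_lt_two)

end CommutingFrame

end CommutingFrames

section Labels

open Metric Set
open scoped NNReal

variable {E₁ E : Type*} [NormedAddCommGroup E₁] [NormedSpace ℝ E₁]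
  [NormedAddCommGroup E] [NormedSpace ℝ E]
  {N : E → E₁ →L[ℝ] E} {ℓ : E →L[ℝ] E₁} {y₀ : E} {ρ : ℝ} {M K C : ℝ≥0}

namespace CommutingFrame

/-- The neighbourhood of `y₀` on which `CommutingFrame.label` distinguishes the leaves. -/
def core (_hN : CommutingFrame N ℓ y₀ ρ M K C) : Set E :=
  ball y₀ (ρ / 4) ∩ {y | M * ‖ℓ (y - y₀)‖ < ρ / 4}

variable (hN : CommutingFrame N ℓ y₀ ρ M K C)
include hN

theorem isOpen_core : IsOpen hN.core :=
  isOpen_ball.inter (isOpen_lt (by fun_prop) continuous_const)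

theorem mem_core : y₀ ∈ hN.core :=
  ⟨mem_ball_self (by linarith [hN.radius_pos]), by simpa using hN.radius_pos⟩

theorem core_subset_ball : hN.core ⊆ ball y₀ ρ := fun _ hy ↦
  ball_subset_ball (by linarith [hN.radius_pos]) hy.1

theorem mul_norm_lt_of_mem_core {y : E} (hy : y ∈ hN.core) : M * ‖ℓ (y - y₀)‖ < ρ / 2 :=
  lt_trans hy.2 (by linarith [hN.radius_pos])

variable [CompleteSpace E]

/-- The point where the leaf through `y` meets the slice `ℓ = ℓ y₀`. -/
def label (y : E) : E := hN.exp (-(ℓ (y - y₀))) y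

theorem label_mem_ball {y : E} (hy : y ∈ hN.core) : hN.label y ∈ ball y₀ (ρ / 2) := by
  have hlabel : dist (hN.label y) y ≤ M * ‖ℓ (y - y₀)‖ := by
    simpa only [label, norm_neg] using hN.dist_exp_le (-(ℓ (y - y₀))) y
  have hball := mem_ball.1 hy.1
  rw [mem_ball]
  linarith [dist_triangle (hN.label y) y y₀, show M * ‖ℓ (y - y₀)‖ < ρ / 4 from hy.2]

theorem exp_label (y : E) : hN.exp (ℓ (y - y₀)) (hN.label y) = y := hN.exp_exp_neg _ _

theorem dist_label_le (y : E) {y' : E} (hy' : y' ∈ hN.core) :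
    dist (hN.label y') (hN.label y) ≤
      Real.exp (K * (‖ℓ‖ * ρ)) * dist y' (hN.exp (ℓ (y' - y₀)) (hN.label y)) := by
  have h := hN.dist_exp_exp_le (-(ℓ (y' - y₀))) y' (hN.exp (ℓ (y' - y₀)) (hN.label y))
  rw [hN.exp_neg_exp, norm_neg, mul_comm] at h
  have hℓ : ‖ℓ (y' - y₀)‖ ≤ ‖ℓ‖ * ρ :=
    ℓ.le_opNorm_of_le (dist_eq_norm y' y₀ ▸ (mem_ball.1 (hN.core_subset_ball hy')).le)
  exact h.trans (by gcongr)

theorem hasFDerivAt_exp_label {y : E} (hy : y ∈ hN.core) :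
    HasFDerivAt (fun y' ↦ hN.exp (ℓ (y' - y₀)) (hN.label y)) (N y ∘L ℓ) y := by
  have h := hN.hasFDerivAt_exp (hN.label_mem_ball hy) (hN.mul_norm_lt_of_mem_core hy)
  rw [hN.exp_label] at h
  exact h.comp (f := fun y' ↦ ℓ (y' - y₀)) y
    (ℓ.hasFDerivAt.comp y ((hasFDerivAt_id y).sub_const y₀))

theorem continuousAt_label {y : E} (hy : y ∈ hN.core) : ContinuousAt hN.label y := by
  have h : Filter.Tendsto (fun y' ↦ Real.exp (K * (‖ℓ‖ * ρ)) *
      dist y' (hN.exp (ℓ (y' - y₀)) (hN.label y))) (𝓝 y) (𝓝 0) := by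
    have : ContinuousAt (fun y' ↦ Real.exp (K * (‖ℓ‖ * ρ)) *
        dist y' (hN.exp (ℓ (y' - y₀)) (hN.label y))) y :=
      (continuousAt_id.dist (hN.hasFDerivAt_exp_label hy).continuousAt).const_mul _
    simpa only [hN.exp_label, dist_self, mul_zero] using this.tendsto
  rw [ContinuousAt, tendsto_iff_dist_tendsto_zero]
  refine squeeze_zero' (Filter.Eventually.of_forall fun _ ↦ dist_nonneg) ?_ h
  filter_upwards [hN.isOpen_core.mem_nhds hy] with y' hy'
  exact hN.dist_label_le y hy'

theorem hasDerivWithinAt_label {c : ℝ → E} {c' : E} {s : Set ℝ} {t : ℝ} (hc : c t ∈ hN.core)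
    (hd : HasDerivWithinAt c c' s t) (hc' : N (c t) (ℓ c') = c') :
    HasDerivWithinAt (fun t ↦ hN.label (c t)) 0 s t := by
  have hsub := hd.sub ((hN.hasFDerivAt_exp_label hc).comp_hasDerivWithinAt t hd)
  rw [ContinuousLinearMap.comp_apply, hc', sub_self] at hsub
  rw [hasDerivWithinAt_iff_isLittleO] at hsub ⊢
  refine Asymptotics.IsBigO.trans_isLittleO ?_ hsub
  refine Asymptotics.IsBigO.of_bound (Real.exp (K * (‖ℓ‖ * ρ))) ?_
  filter_upwards [hd.continuousWithinAt (hN.isOpen_core.mem_nhds hc)] with t' ht'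
  simpa only [dist_eq_norm, Pi.sub_apply, Function.comp_apply, hN.exp_label, sub_self, sub_zero,
    smul_zero] using hN.dist_label_le (c t) ht'

theorem apply_proj_eq_of_label_eq {c : ℝ → E} {c' : E} {t : ℝ} (hc : c t ∈ hN.core)
    (hd : HasDerivAt c c' t) (hl : ∀ᶠ t' in 𝓝 t, hN.label (c t') = hN.label (c t)) :
    N (c t) (ℓ c') = c' := by
  refine ((hN.hasFDerivAt_exp_label hc).comp_hasDerivAt t hd).unique
    (hd.congr_of_eventuallyEq ?_)
  filter_upwards [hl] with t' ht'
  rw [Function.comp_apply, ← ht', hN.exp_label]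

theorem exists_tangent_curve {y : E} (hy : y ∈ hN.core) {O : Set E} (hO : O ∈ 𝓝 y) :
    ∃ u ∈ 𝓝 y, ∀ y' ∈ u, hN.label y' = hN.label y → ∃ (c : ℝ → E) (w : E₁), c 0 = y ∧ c 1 = y' ∧
      ∀ t ∈ Icc (0 : ℝ) 1, c t ∈ O ∧ HasDerivAt c (N (c t) w) t := by
  have hz := hN.label_mem_ball hy
  have hsmall := hN.mul_norm_lt_of_mem_core hy
  have mem_O : ∀ᶠ v in 𝓝 (ℓ (y - y₀)), hN.exp v (hN.label y) ∈ O :=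
    (hN.hasFDerivAt_exp hz hsmall).continuousAt.eventually_mem (by rwa [hN.exp_label])
  have small : ∀ᶠ v in 𝓝 (ℓ (y - y₀)), M * ‖v‖ < ρ / 2 :=
    (by fun_prop : Continuous fun v : E₁ ↦ M * ‖v‖).continuousAt.eventually_lt
      continuousAt_const hsmall
  obtain ⟨δ, hδ, hball⟩ := Metric.eventually_nhds_iff_ball.1 (mem_O.and small)
  have proj_mem_ball : ∀ᶠ y' in 𝓝 y, ℓ (y' - y₀) ∈ ball (ℓ (y - y₀)) δ :=
    (by fun_prop : Continuous fun y' ↦ ℓ (y' - y₀)).continuousAt.eventually_mem (ball_mem_nhds _ hδ)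
  refine ⟨_, proj_mem_ball, fun y' hy' hl ↦ ?_⟩
  set w := ℓ (y' - y₀) - ℓ (y - y₀) with hw
  refine ⟨fun t ↦ hN.exp (ℓ (y - y₀) + t • w) (hN.label y), w, ?_, ?_, fun t ht ↦ ?_⟩
  · simp only [zero_smul, add_zero, hN.exp_label]
  · simp only [hw, one_smul, add_sub_cancel, ← hl, hN.exp_label]
  · have hm := hball _ ((convex_ball (ℓ (y - y₀)) δ).add_smul_sub_mem (mem_ball_self hδ) hy' ht)
    have hline : HasDerivAt (fun t : ℝ ↦ ℓ (y - y₀) + t • w) w t := by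
      have h := ((hasDerivAt_id t).smul_const w).const_add (ℓ (y - y₀))
      rwa [one_smul] at h
    have hderiv := (hN.hasFDerivAt_exp hz hm.2).comp_hasDerivAt t hline
    exact ⟨hm.1, hderiv⟩

end CommutingFrame

end Labels

section NormalForms

open Metric Set
open scoped NNReal

variable {E₁ E F : Type*} [NormedAddCommGroup E₁] [NormedSpace ℝ E₁]
  [NormedAddCommGroup E] [NormedSpace ℝ E] [NormedAddCommGroup F] [NormedSpace ℝ F]

theorem exists_contDiff_hasCompactSupport_eventuallyEq [FiniteDimensional ℝ E] {f : E → F} {x : E}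
    {n : ℕ} (hf : ContDiffAt ℝ n f x) :
    ∃ g : E → F, ContDiff ℝ n g ∧ HasCompactSupport g ∧ g =ᶠ[𝓝 x] f := by
  obtain ⟨R, hR, hball⟩ := Metric.eventually_nhds_iff_ball.1 (hf.eventually (by simp))
  let χ : ContDiffBump x := ⟨R / 3, R / 2, by positivity, by linarith⟩
  have tsupport_subset : tsupport χ ⊆ ball x R :=
    χ.tsupport_eq.trans_subset (closedBall_subset_ball (half_lt_self hR))
  refine ⟨fun y ↦ χ y • f y, contDiff_iff_contDiffAt.2 fun y ↦ ?_, χ.hasCompactSupport.smul_right,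
    ?_⟩
  · by_cases hy : y ∈ tsupport χ
    · exact χ.contDiffAt.smul (hball y (tsupport_subset hy))
    · refine (contDiffAt_const (c := (0 : F))).congr_of_eventuallyEq ?_
      filter_upwards [notMem_tsupport_iff_eventuallyEq.1 hy] with z hz
      rw [hz, Pi.zero_apply, zero_smul]
  · filter_upwards [χ.eventuallyEq_one] with y hy
    rw [hy, Pi.one_apply, one_smul]

theorem exists_commutingFrame_eventuallyEq [FiniteDimensional ℝ E] {N₀ : E → E₁ →L[ℝ] E}
    {ℓ : E →L[ℝ] E₁} {y₀ : E} (hN₀ : ContDiffAt ℝ 2 N₀ y₀)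
    (hl : ∀ᶠ y in 𝓝 y₀, ∀ a, ℓ (N₀ y a) = a)
    (hc : ∀ᶠ y in 𝓝 y₀, ∀ a b, fderiv ℝ N₀ y (N₀ y a) b = fderiv ℝ N₀ y (N₀ y b) a)
    {s : Set E} (hs : s ∈ 𝓝 y₀) :
    ∃ (N : E → E₁ →L[ℝ] E) (ρ : ℝ) (M K C : ℝ≥0), CommutingFrame N ℓ y₀ ρ M K C ∧
      ball y₀ ρ ⊆ s ∧ ∀ y ∈ ball y₀ ρ, N y = N₀ y := by
  obtain ⟨N, hN, hsupp, heq⟩ : ∃ N : E → E₁ →L[ℝ] E, ContDiff ℝ 2 N ∧ HasCompactSupport N ∧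
      N =ᶠ[𝓝 y₀] N₀ := exists_contDiff_hasCompactSupport_eventuallyEq (n := 2) hN₀
  have hN' : ContDiff ℝ 1 (fderiv ℝ N) := hN.fderiv_right (by norm_num)
  obtain ⟨M, hM⟩ := hsupp.exists_bound_of_continuous hN.continuous
  obtain ⟨K, hK⟩ := ContDiff.lipschitzWith_of_hasCompactSupport hsupp hN two_ne_zero
  obtain ⟨C, hC⟩ : ∃ C : ℝ≥0, LipschitzWith C (fderiv ℝ N) :=
    ContDiff.lipschitzWith_of_hasCompactSupport (hsupp.fderiv ℝ) hN' one_ne_zero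
  obtain ⟨ρ, hρ, hball⟩ := Metric.eventually_nhds_iff_ball.1
    (heq.eventually_nhds.and (hl.and (hc.and hs)))
  have eqOn_ball : ∀ y ∈ ball y₀ ρ, N y = N₀ y := fun y hy ↦ (hball y hy).1.self_of_nhds
  refine ⟨N, ρ, ⟨M, (norm_nonneg _).trans (hM y₀)⟩, K, C,
    { norm_le := hM
      lipschitz := hK
      differentiable := hN.differentiable two_ne_zero
      lipschitz_fderiv := hC
      radius_pos := hρ
      left_inv := fun y hy ↦ ?_
      comm := fun y hy ↦ ?_ }, fun y hy ↦ (hball y hy).2.2.2, eqOn_ball⟩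
  · rw [eqOn_ball y hy]
    exact (hball y hy).2.1
  · rw [eqOn_ball y hy, Filter.EventuallyEq.fderiv_eq (hball y hy).1]
    exact (hball y hy).2.2.1

theorem exists_normalization [FiniteDimensional ℝ E] [FiniteDimensional ℝ F] {A : E → F →L[ℝ] E}
    {u : Set E} {y₀ : E} {n : ℕ∞} (hu : IsOpen u) (hy₀ : y₀ ∈ u) (hA : ContDiffOn ℝ n A u)
    (hinj : Function.Injective (A y₀)) :
    ∃ (N : E → F →L[ℝ] E) (ℓ : E →L[ℝ] F) (u' : Set E), IsOpen u' ∧ y₀ ∈ u' ∧ u' ⊆ u ∧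
      ContDiffOn ℝ n N u' ∧ (∀ y ∈ u', ∀ a, ℓ (N y a) = a) ∧
      ∀ y ∈ u', (N y).range = (A y).range := by
  obtain ⟨g, hg⟩ := (A y₀).toLinearMap.exists_leftInverse_of_injective (LinearMap.ker_eq_bot.2 hinj)
  let ℓ : E →L[ℝ] F := LinearMap.toContinuousLinearMap g
  let T : E → F →L[ℝ] F := fun y ↦ ℓ ∘L A y
  have hT₀ : T y₀ = 1 := ContinuousLinearMap.ext fun a ↦ LinearMap.congr_fun hg a
  have hT : ContDiffOn ℝ n T u := contDiffOn_const.clm_comp hA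
  let u' := u ∩ T ⁻¹' {x | IsUnit x}
  have contDiffOn_inverse : ContDiffOn ℝ n (fun y ↦ Ring.inverse (T y)) u' := fun y hy ↦ by
    obtain ⟨x, hx⟩ := hy.2
    exact (hx ▸ contDiffAt_ringInverse ℝ x).comp_contDiffWithinAt y
      ((hT y hy.1).mono inter_subset_left)
  refine ⟨fun y ↦ A y ∘L Ring.inverse (T y), ℓ, u',
    hT.continuousOn.isOpen_inter_preimage hu Units.isOpen, ⟨hy₀, by simp [hT₀]⟩, inter_subset_left,
    (hA.mono inter_subset_left).clm_comp contDiffOn_inverse,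
    fun y hy a ↦ DFunLike.congr_fun (Ring.mul_inverse_cancel (T y) hy.2) a, fun y hy ↦ ?_⟩
  exact LinearMap.range_comp_of_range_eq_top (f := (Ring.inverse (T y)).toLinearMap)
    (A y).toLinearMap (LinearMap.range_eq_top.2 fun b ↦
      ⟨T y b, DFunLike.congr_fun (Ring.inverse_mul_cancel (T y) hy.2) b⟩)

theorem exists_normalized_frame [FiniteDimensional ℝ E] {k : ℕ} {X : Fin k → E → E} {u : Set E}
    {y₀ : E} {n : ℕ∞} (hu : IsOpen u) (hy₀ : y₀ ∈ u) (hX : ∀ i, ContDiffOn ℝ n (X i) u)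
    (hli : LinearIndependent ℝ fun i ↦ X i y₀) :
    ∃ (N : E → (Fin k → ℝ) →L[ℝ] E) (ℓ : E →L[ℝ] Fin k → ℝ) (u' : Set E), IsOpen u' ∧ y₀ ∈ u' ∧
      u' ⊆ u ∧ ContDiffOn ℝ n N u' ∧ (∀ y ∈ u', ∀ a, ℓ (N y a) = a) ∧
      ∀ y ∈ u', (N y).range = Submodule.span ℝ (range fun i ↦ X i y) := by
  let A : E → (Fin k → ℝ) →L[ℝ] E := fun y ↦ ∑ i, (ContinuousLinearMap.proj i).smulRight (X i y)
  have hA : ContDiffOn ℝ n A u := ContDiffOn.sum fun i _ ↦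
    (ContinuousLinearMap.smulRightL ℝ (Fin k → ℝ) E
      (ContinuousLinearMap.proj i)).contDiff.comp_contDiffOn (hX i)
  have toLinearMap_A : ∀ y, (A y).toLinearMap = Fintype.linearCombination ℝ fun i ↦ X i y :=
    fun y ↦ by
      ext i
      simp [A, Fintype.linearCombination_apply]
  simp only [← Fintype.range_linearCombination, ← toLinearMap_A]
  refine exists_normalization hu hy₀ hA ?_
  rw [← ContinuousLinearMap.coe_coe, toLinearMap_A]
  exact hli.fintypeLinearCombination_injective

end NormalForms

/-! ### Distributions in charts -/

section Charts

open Set VectorField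

variable {E : Type*} [NormedAddCommGroup E] [NormedSpace ℝ E]
  {M : Type*} [TopologicalSpace M] [ChartedSpace E M]

theorem isOpen_inter_preimage_chart (m₀ : M) {u : Set E} (hu : IsOpen u) :
    IsOpen ((extChartAt 𝓘(ℝ, E) m₀).source ∩ extChartAt 𝓘(ℝ, E) m₀ ⁻¹' u) :=
  (continuousOn_extChartAt m₀).isOpen_inter_preimage (isOpen_extChartAt_source m₀) hu

theorem isOpen_inter_preimage_chart_symm (m₀ : M) {u : Set M} (hu : IsOpen u) :
    IsOpen ((extChartAt 𝓘(ℝ, E) m₀).target ∩ (extChartAt 𝓘(ℝ, E) m₀).symm ⁻¹' u) :=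
  (continuousOn_extChartAt_symm m₀).isOpen_inter_preimage (isOpen_extChartAt_target m₀) hu

variable [IsManifold 𝓘(ℝ, E) ∞ M] {m₀ m : M} {y : E}

theorem contMDiffAt_chart (hm : m ∈ (extChartAt 𝓘(ℝ, E) m₀).source) :
    ContMDiffAt 𝓘(ℝ, E) 𝓘(ℝ, E) ∞ (extChartAt 𝓘(ℝ, E) m₀) m :=
  contMDiffAt_extChartAt' (by rwa [← extChartAt_source 𝓘(ℝ, E)])

theorem contMDiffAt_chart_symm (hy : y ∈ (extChartAt 𝓘(ℝ, E) m₀).target) :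
    ContMDiffAt 𝓘(ℝ, E) 𝓘(ℝ, E) ∞ (extChartAt 𝓘(ℝ, E) m₀).symm y :=
  (contMDiffOn_extChartAt_symm m₀).contMDiffAt ((isOpen_extChartAt_target m₀).mem_nhds hy)

theorem mdifferentiableAt_chart (hm : m ∈ (extChartAt 𝓘(ℝ, E) m₀).source) :
    MDifferentiableAt 𝓘(ℝ, E) 𝓘(ℝ, E) (extChartAt 𝓘(ℝ, E) m₀) m :=
  (contMDiffAt_chart hm).mdifferentiableAt (by simp)

theorem mdifferentiableAt_chart_symm (hy : y ∈ (extChartAt 𝓘(ℝ, E) m₀).target) :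
    MDifferentiableAt 𝓘(ℝ, E) 𝓘(ℝ, E) (extChartAt 𝓘(ℝ, E) m₀).symm y :=
  (contMDiffAt_chart_symm hy).mdifferentiableAt (by simp)

theorem isInvertible_mfderiv_chart_symm (hy : y ∈ (extChartAt 𝓘(ℝ, E) m₀).target) :
    (mfderiv 𝓘(ℝ, E) 𝓘(ℝ, E) (extChartAt 𝓘(ℝ, E) m₀).symm y).IsInvertible := by
  have h := isInvertible_mfderivWithin_extChartAt_symm (I := 𝓘(ℝ, E)) hy
  rwa [modelWithCornersSelf_coe, range_id, mfderivWithin_univ] at h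

theorem mfderiv_chart_symm_mfderiv_chart (hm : m ∈ (extChartAt 𝓘(ℝ, E) m₀).source)
    (a : TangentSpace 𝓘(ℝ, E) m) :
    mfderiv 𝓘(ℝ, E) 𝓘(ℝ, E) (extChartAt 𝓘(ℝ, E) m₀).symm (extChartAt 𝓘(ℝ, E) m₀ m)
      (mfderiv 𝓘(ℝ, E) 𝓘(ℝ, E) (extChartAt 𝓘(ℝ, E) m₀) m a) = a := by
  have h := mfderivWithin_extChartAt_symm_comp_mfderiv_extChartAt' (I := 𝓘(ℝ, E)) hm
  rw [modelWithCornersSelf_coe, range_id, mfderivWithin_univ] at h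
  exact DFunLike.congr_fun h a

theorem mfderiv_chart_mfderiv_chart_symm (hy : y ∈ (extChartAt 𝓘(ℝ, E) m₀).target) (a : E) :
    mfderiv 𝓘(ℝ, E) 𝓘(ℝ, E) (extChartAt 𝓘(ℝ, E) m₀) ((extChartAt 𝓘(ℝ, E) m₀).symm y)
      (mfderiv 𝓘(ℝ, E) 𝓘(ℝ, E) (extChartAt 𝓘(ℝ, E) m₀).symm y a) = a := by
  have h := mfderiv_extChartAt_comp_mfderivWithin_extChartAt_symm (I := 𝓘(ℝ, E)) hy
  rw [modelWithCornersSelf_coe, range_id, mfderivWithin_univ] at h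
  exact DFunLike.congr_fun h a

theorem mfderiv_chart_injective (hm : m ∈ (extChartAt 𝓘(ℝ, E) m₀).source) :
    Function.Injective (mfderiv 𝓘(ℝ, E) 𝓘(ℝ, E) (extChartAt 𝓘(ℝ, E) m₀) m) :=
  Function.LeftInverse.injective (mfderiv_chart_symm_mfderiv_chart hm)

theorem mpullback_chart_symm_apply (hm : m ∈ (extChartAt 𝓘(ℝ, E) m₀).source)
    (X : ∀ m : M, TangentSpace 𝓘(ℝ, E) m) :
    mpullback 𝓘(ℝ, E) 𝓘(ℝ, E) (extChartAt 𝓘(ℝ, E) m₀).symm X (extChartAt 𝓘(ℝ, E) m₀ m) =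
      mfderiv 𝓘(ℝ, E) 𝓘(ℝ, E) (extChartAt 𝓘(ℝ, E) m₀) m (X m) := by
  rw [mpullback_apply, PartialEquiv.left_inv _ hm]
  exact (isInvertible_mfderiv_chart_symm (PartialEquiv.map_source _ hm)).inverse_apply_eq.2
    (mfderiv_chart_symm_mfderiv_chart hm _).symm

theorem mfderiv_chart_mpullback (hm : m ∈ (extChartAt 𝓘(ℝ, E) m₀).source)
    (Y : ∀ y : E, TangentSpace 𝓘(ℝ, E) y) :
    mfderiv 𝓘(ℝ, E) 𝓘(ℝ, E) (extChartAt 𝓘(ℝ, E) m₀) m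
      (mpullback 𝓘(ℝ, E) 𝓘(ℝ, E) (extChartAt 𝓘(ℝ, E) m₀) Y m) = Y (extChartAt 𝓘(ℝ, E) m₀ m) :=
  ((isInvertible_mfderiv_extChartAt hm).inverse_apply_eq.1 rfl).symm

theorem contDiffOn_mpullback_chart_symm [CompleteSpace E] (m₀ : M)
    {X : ∀ m : M, TangentSpace 𝓘(ℝ, E) m} {u : Set M} (hu : IsOpen u)
    (hX : ContMDiffOn 𝓘(ℝ, E) 𝓘(ℝ, E).tangent ∞
      (fun m ↦ (⟨m, X m⟩ : TangentBundle 𝓘(ℝ, E) M)) u) :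
    ContDiffOn ℝ ∞ (mpullback 𝓘(ℝ, E) 𝓘(ℝ, E) (extChartAt 𝓘(ℝ, E) m₀).symm X : E → E)
      ((extChartAt 𝓘(ℝ, E) m₀).target ∩ (extChartAt 𝓘(ℝ, E) m₀).symm ⁻¹' u) := fun y hy ↦ by
  have h := ContMDiffAt.mpullback_vectorField_preimage (m := ∞) (n := ∞)
    (hX.contMDiffAt (hu.mem_nhds hy.2)) (contMDiffAt_chart_symm hy.1)
    (isInvertible_mfderiv_chart_symm hy.1) (by simp)
  exact (contMDiffAt_vectorSpace_iff_contDiffAt.1 h).contDiffWithinAt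

theorem contMDiffOn_mpullback_chart [CompleteSpace E] (m₀ : M) {Y : E → E} {u : Set E}
    (hu : IsOpen u) (hY : ContDiffOn ℝ ∞ Y u) :
    ContMDiffOn 𝓘(ℝ, E) 𝓘(ℝ, E).tangent ∞
      (fun m ↦ (⟨m, mpullback 𝓘(ℝ, E) 𝓘(ℝ, E) (extChartAt 𝓘(ℝ, E) m₀) Y m⟩ :
        TangentBundle 𝓘(ℝ, E) M))
      ((extChartAt 𝓘(ℝ, E) m₀).source ∩ extChartAt 𝓘(ℝ, E) m₀ ⁻¹' u) := fun m hm ↦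
  (ContMDiffAt.mpullback_vectorField_preimage (m := ∞) (n := ∞)
    (contMDiffAt_vectorSpace_iff_contDiffAt.2 (hY.contDiffAt (hu.mem_nhds hm.2)))
    (contMDiffAt_chart hm.1) (isInvertible_mfderiv_extChartAt hm.1)
    (by simp)).contMDiffWithinAt

theorem mlieBracket_eq_lieBracket (X Y : E → E) :
    mlieBracket 𝓘(ℝ, E) X Y = lieBracket ℝ X Y :=
  mlieBracketWithin_univ.symm.trans <|
    mlieBracketWithin_eq_lieBracketWithin.trans lieBracketWithin_univ

theorem mlieBracket_mpullback_chart [CompleteSpace E]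
    (hm : m ∈ (extChartAt 𝓘(ℝ, E) m₀).source) {X Y : E → E}
    (hX : ContDiffAt ℝ 1 X (extChartAt 𝓘(ℝ, E) m₀ m))
    (hY : ContDiffAt ℝ 1 Y (extChartAt 𝓘(ℝ, E) m₀ m)) :
    mlieBracket 𝓘(ℝ, E) (mpullback 𝓘(ℝ, E) 𝓘(ℝ, E) (extChartAt 𝓘(ℝ, E) m₀) X)
      (mpullback 𝓘(ℝ, E) 𝓘(ℝ, E) (extChartAt 𝓘(ℝ, E) m₀) Y) m =
      mpullback 𝓘(ℝ, E) 𝓘(ℝ, E) (extChartAt 𝓘(ℝ, E) m₀) (lieBracket ℝ X Y) m := by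
  have : IsManifold 𝓘(ℝ, E) (minSmoothness ℝ 2) M := by
    rw [minSmoothness_of_isRCLikeNormedField]
    exact IsManifold.of_le (n := ∞) (by exact ENat.LEInfty.out)
  rw [← mlieBracket_eq_lieBracket]
  refine (mpullback_mlieBracket (n := ∞)
    ((contMDiffAt_vectorSpace_iff_contDiffAt.2 hX).mdifferentiableAt one_ne_zero)
    ((contMDiffAt_vectorSpace_iff_contDiffAt.2 hY).mdifferentiableAt one_ne_zero)
    (contMDiffAt_chart hm) ?_).symm
  rw [minSmoothness_of_isRCLikeNormedField]
  exact ENat.LEInfty.out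

end Charts

section NormalizedFrames

open Set VectorField

variable {E₁ E : Type*} [NormedAddCommGroup E₁] [NormedSpace ℝ E₁]
  [NormedAddCommGroup E] [NormedSpace ℝ E] {M : Type*} [TopologicalSpace M] [ChartedSpace E M]

/-- In the chart at `m₀`, the distribution `Δ` is the range of the frame `N` over the open set `u`.
The frame is normalized by a left inverse `ℓ` not depending on the point, so that `N y ∘ ℓ` is a
projection onto the distribution. -/
structure IsNormalizedFrame (Δ : ∀ m : M, Submodule ℝ (TangentSpace 𝓘(ℝ, E) m)) (m₀ : M)
    (N : E → E₁ →L[ℝ] E) (ℓ : E →L[ℝ] E₁) (u : Set E) : Prop where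
  isOpen : IsOpen u
  mem : extChartAt 𝓘(ℝ, E) m₀ m₀ ∈ u
  subset_target : u ⊆ (extChartAt 𝓘(ℝ, E) m₀).target
  contDiffOn : ContDiffOn ℝ ∞ N u
  left_inv : ∀ y ∈ u, ∀ a, ℓ (N y a) = a
  mem_iff : ∀ m ∈ (extChartAt 𝓘(ℝ, E) m₀).source, extChartAt 𝓘(ℝ, E) m₀ m ∈ u →
    ∀ b : TangentSpace 𝓘(ℝ, E) m, b ∈ Δ m ↔
      N (extChartAt 𝓘(ℝ, E) m₀ m) (ℓ (mfderiv 𝓘(ℝ, E) 𝓘(ℝ, E) (extChartAt 𝓘(ℝ, E) m₀) m b)) =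
        mfderiv 𝓘(ℝ, E) 𝓘(ℝ, E) (extChartAt 𝓘(ℝ, E) m₀) m b

namespace IsNormalizedFrame

variable {Δ : ∀ m : M, Submodule ℝ (TangentSpace 𝓘(ℝ, E) m)} {m₀ : M} {N N' : E → E₁ →L[ℝ] E}
  {ℓ : E →L[ℝ] E₁} {u u' : Set E}

theorem congr (h : IsNormalizedFrame Δ m₀ N ℓ u) (hu' : IsOpen u')
    (hm₀ : extChartAt 𝓘(ℝ, E) m₀ m₀ ∈ u') (hsub : u' ⊆ u) (heq : ∀ y ∈ u', N' y = N y) :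
    IsNormalizedFrame Δ m₀ N' ℓ u' where
  isOpen := hu'
  mem := hm₀
  subset_target := hsub.trans h.subset_target
  contDiffOn := (h.contDiffOn.mono hsub).congr heq
  left_inv y hy := heq y hy ▸ h.left_inv y (hsub hy)
  mem_iff m hm hmu := heq _ hmu ▸ h.mem_iff m hm (hsub hmu)

variable (h : IsNormalizedFrame Δ m₀ N ℓ u)
include h

theorem contDiffAt {y : E} (hy : y ∈ u) : ContDiffAt ℝ ∞ N y :=
  h.contDiffOn.contDiffAt (h.isOpen.mem_nhds hy)

theorem differentiableAt {y : E} (hy : y ∈ u) : DifferentiableAt ℝ N y :=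
  (h.contDiffAt hy).differentiableAt (by simp)

theorem proj_fderiv_apply {y : E} (hy : y ∈ u) (v : E) (a : E₁) : ℓ (fderiv ℝ N y v a) = 0 := by
  let comp_proj := ContinuousLinearMap.compL ℝ E₁ E E₁ ℓ
  have hderiv : HasFDerivAt (fun z ↦ ℓ ∘L N z) (comp_proj ∘L fderiv ℝ N y) y :=
    comp_proj.hasFDerivAt.comp y (h.differentiableAt hy).hasFDerivAt
  have hconst : (fun z ↦ ℓ ∘L N z) =ᶠ[𝓝 y] fun _ ↦ ContinuousLinearMap.id ℝ E₁ := by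
    filter_upwards [h.isOpen.mem_nhds hy] with z hz
    exact ContinuousLinearMap.ext (h.left_inv z hz)
  have hzero := hderiv.unique ((hasFDerivAt_const _ y).congr_of_eventuallyEq hconst)
  exact DFunLike.congr_fun (DFunLike.congr_fun hzero v) a

theorem mem_iff_of_mfderiv_eq {m : M} (hm : m ∈ (extChartAt 𝓘(ℝ, E) m₀).source)
    (hmu : extChartAt 𝓘(ℝ, E) m₀ m ∈ u) {b : TangentSpace 𝓘(ℝ, E) m} {e : E}
    (hb : mfderiv 𝓘(ℝ, E) 𝓘(ℝ, E) (extChartAt 𝓘(ℝ, E) m₀) m b = e) :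
    b ∈ Δ m ↔ N (extChartAt 𝓘(ℝ, E) m₀ m) (ℓ e) = e := by
  subst hb
  exact h.mem_iff m hm hmu b

variable [IsManifold 𝓘(ℝ, E) ∞ M]

theorem mfderiv_chart_symm_mem {y : E} (hy : y ∈ u) (a : E₁) :
    mfderiv 𝓘(ℝ, E) 𝓘(ℝ, E) (extChartAt 𝓘(ℝ, E) m₀).symm y (N y a) ∈
      Δ ((extChartAt 𝓘(ℝ, E) m₀).symm y) := by
  have hyt := h.subset_target hy
  have hmy := PartialEquiv.right_inv _ hyt
  rw [h.mem_iff_of_mfderiv_eq (PartialEquiv.map_target _ hyt) (hmy.symm ▸ hy)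
    (mfderiv_chart_mfderiv_chart_symm hyt (N y a)), hmy, h.left_inv y hy]

theorem mpullback_mem_iff {m : M} (hm : m ∈ (extChartAt 𝓘(ℝ, E) m₀).source)
    (hmu : extChartAt 𝓘(ℝ, E) m₀ m ∈ u) (Y : E → E) :
    mpullback 𝓘(ℝ, E) 𝓘(ℝ, E) (extChartAt 𝓘(ℝ, E) m₀) Y m ∈ Δ m ↔
      N (extChartAt 𝓘(ℝ, E) m₀ m) (ℓ (Y (extChartAt 𝓘(ℝ, E) m₀ m))) =
        Y (extChartAt 𝓘(ℝ, E) m₀ m) :=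
  h.mem_iff_of_mfderiv_eq hm hmu (mfderiv_chart_mpullback hm Y)

theorem apply_proj_lieBracket [CompleteSpace E] (hI : IsInvolutive Δ) {y : E} (hy : y ∈ u)
    (a b : E₁) :
    N y (ℓ (lieBracket ℝ (fun z ↦ N z a) (fun z ↦ N z b) y)) =
      lieBracket ℝ (fun z ↦ N z a) (fun z ↦ N z b) y := by
  set φ := extChartAt 𝓘(ℝ, E) m₀ with hφ
  have smooth (a : E₁) := contMDiffOn_mpullback_chart m₀ h.isOpen
    (h.contDiffOn.clm_apply (contDiffOn_const (c := a)))
  have mem (a : E₁) : ∀ m ∈ φ.source ∩ φ ⁻¹' u,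
      mpullback 𝓘(ℝ, E) 𝓘(ℝ, E) φ (fun z ↦ N z a) m ∈ Δ m := fun m hm ↦
    (h.mpullback_mem_iff hm.1 hm.2 _).2 (congrArg _ (h.left_inv _ hm.2 a))
  have hm : φ.symm y ∈ φ.source := φ.map_target (h.subset_target hy)
  have hmy : φ (φ.symm y) = y := φ.right_inv (h.subset_target hy)
  have hmu : φ (φ.symm y) ∈ u := hmy.symm ▸ hy
  have contDiffAt_apply (a : E₁) : ContDiffAt ℝ 1 (fun z ↦ N z a) (φ (φ.symm y)) :=
    ((h.contDiffAt hmu).of_le ENat.LEInfty.out).clm_apply contDiffAt_const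
  have bracket_mem := hI _ _ _ (isOpen_inter_preimage_chart m₀ h.isOpen) (smooth a) (smooth b)
    (mem a) (mem b) (φ.symm y) ⟨hm, hmu⟩
  rw [mlieBracket_mpullback_chart hm (contDiffAt_apply a) (contDiffAt_apply b),
    h.mpullback_mem_iff hm hmu] at bracket_mem
  rwa [← hφ, hmy] at bracket_mem

/-- The bracket of two vector fields `N a`, `N b` lies in the range of `N`, but `ℓ` kills it since
`ℓ ∘ N` is constant. -/
theorem comm [CompleteSpace E] (hI : IsInvolutive Δ) {y : E} (hy : y ∈ u) (a b : E₁) :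
    fderiv ℝ N y (N y a) b = fderiv ℝ N y (N y b) a := by
  have fderiv_apply (a : E₁) (v : E) : fderiv ℝ (fun z ↦ N z a) y v = fderiv ℝ N y v a := by
    simp [fderiv_clm_apply (h.differentiableAt hy) (differentiableAt_const a)]
  have hL := h.apply_proj_lieBracket hI hy a b
  simp only [lieBracket, fderiv_apply, map_sub, h.proj_fderiv_apply hy, sub_zero, map_zero] at hL
  exact sub_eq_zero.1 hL.symm

end IsNormalizedFrame

theorem exists_isNormalizedFrame [IsManifold 𝓘(ℝ, E) ∞ M] [FiniteDimensional ℝ E]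
    {Δ : ∀ m : M, Submodule ℝ (TangentSpace 𝓘(ℝ, E) m)} (hΔ : IsDistribution Δ) (m₀ : M) :
    ∃ (k : ℕ) (N : E → (Fin k → ℝ) →L[ℝ] E) (ℓ : E →L[ℝ] Fin k → ℝ) (u : Set E),
      IsNormalizedFrame Δ m₀ N ℓ u := by
  have : CompleteSpace E := FiniteDimensional.complete ℝ E
  obtain ⟨k, w, X, hw, hm₀, hX, hspan⟩ := hΔ m₀
  set φ := extChartAt 𝓘(ℝ, E) m₀
  let Y : Fin k → E → E := fun i ↦ mpullback 𝓘(ℝ, E) 𝓘(ℝ, E) φ.symm (X i)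
  let T : ∀ m : M, TangentSpace 𝓘(ℝ, E) m →ₗ[ℝ] E := fun m ↦
    (mfderiv 𝓘(ℝ, E) 𝓘(ℝ, E) φ m).toLinearMap
  have hY : ∀ m ∈ φ.source, (fun i ↦ Y i (φ m)) = T m ∘ fun i ↦ X i m := fun m hm ↦
    funext fun i ↦ mpullback_chart_symm_apply hm (X i)
  have hm₀' := mem_extChartAt_source (I := 𝓘(ℝ, E)) m₀
  have hli : LinearIndependent ℝ fun i ↦ Y i (φ m₀) := by
    rw [hY m₀ hm₀']
    exact (hspan m₀ hm₀).1.map' _ (LinearMap.ker_eq_bot.2 (mfderiv_chart_injective hm₀'))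
  obtain ⟨N, ℓ, u, hu, hm₀u, hsub, hN, left_inv, range_eq⟩ :=
    exists_normalized_frame (isOpen_inter_preimage_chart_symm m₀ hw)
      ⟨mem_extChartAt_target m₀, by rwa [mem_preimage, extChartAt_to_inv]⟩
      (fun i ↦ contDiffOn_mpullback_chart_symm m₀ hw (hX i)) hli
  refine ⟨k, N, ℓ, u, hu, hm₀u, fun y hy ↦ (hsub hy).1, hN, left_inv, fun m hm hmu b ↦ ?_⟩
  have hmw : m ∈ w := φ.left_inv hm ▸ (hsub hmu).2
  have mem_iff_mem_range : b ∈ Δ m ↔ T m b ∈ (N (φ m)).range := by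
    have range_eq_map : (N (φ m)).range = (Δ m).map (T m) := by
      rw [range_eq _ hmu, ← (hspan m hmw).2, ← Submodule.span_image, ← range_comp, ← hY m hm]
    rw [range_eq_map, Submodule.mem_map]
    exact ((mfderiv_chart_injective hm).mem_set_image (s := (Δ m : Set _))).symm
  rw [mem_iff_mem_range]
  refine ⟨?_, fun h ↦ ⟨_, h⟩⟩
  rintro ⟨a, ha⟩
  have ha' : N (φ m) a = mfderiv 𝓘(ℝ, E) 𝓘(ℝ, E) φ m b := ha
  rw [← ha', left_inv _ hmu]

end NormalizedFrames

section LeafCharts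

open Metric Set
open scoped NNReal

variable {E₁ E : Type*} [NormedAddCommGroup E₁] [NormedSpace ℝ E₁]
  [NormedAddCommGroup E] [NormedSpace ℝ E] {M : Type*} [TopologicalSpace M] [ChartedSpace E M]

/-- The curve `c` is differentiable within `s`, with derivative in `Δ`. -/
def IsTangentOn (Δ : ∀ m : M, Submodule ℝ (TangentSpace 𝓘(ℝ, E) m)) (c : ℝ → M) (s : Set ℝ) :
    Prop :=
  ∀ t ∈ s, ∃ c' : TangentSpace 𝓘(ℝ, ℝ) t →L[ℝ] TangentSpace 𝓘(ℝ, E) (c t),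
    HasMFDerivWithinAt 𝓘(ℝ, ℝ) 𝓘(ℝ, E) c s t c' ∧ c' (1 : ℝ) ∈ Δ (c t)

/-- A continuous map on an open set of `M` which distinguishes the local leaves of the distribution
`Δ`, even though no integral manifolds are constructed: it has zero derivative along curves tangent
to `Δ`, a curve on which it is constant is tangent to `Δ`, and nearby points with the same label are
joined by a short curve tangent to `Δ`. -/
structure LeafChart (Δ : ∀ m : M, Submodule ℝ (TangentSpace 𝓘(ℝ, E) m)) where
  /-- the domain -/
  source : Set M
  /-- the map that is constant on the local leaves -/
  label : M → E
  isOpen : IsOpen source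
  continuousOn : ContinuousOn label source
  hasDerivWithinAt : ∀ {c : ℝ → M} {s : Set ℝ} {t : ℝ}
    {c' : TangentSpace 𝓘(ℝ, ℝ) t →L[ℝ] TangentSpace 𝓘(ℝ, E) (c t)}, c t ∈ source →
    HasMFDerivWithinAt 𝓘(ℝ, ℝ) 𝓘(ℝ, E) c s t c' → c' (1 : ℝ) ∈ Δ (c t) →
    HasDerivWithinAt (fun t ↦ label (c t)) 0 s t
  tangent : ∀ {c : ℝ → M} {t : ℝ}
    {c' : TangentSpace 𝓘(ℝ, ℝ) t →L[ℝ] TangentSpace 𝓘(ℝ, E) (c t)}, c t ∈ source →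
    HasMFDerivAt 𝓘(ℝ, ℝ) 𝓘(ℝ, E) c t c' → (∀ᶠ t' in 𝓝 t, label (c t') = label (c t)) →
    c' (1 : ℝ) ∈ Δ (c t)
  exists_curve : ∀ m ∈ source, ∀ O ∈ 𝓝 m, ∃ u ∈ 𝓝 m, ∀ m' ∈ u, label m' = label m →
    ∃ c : ℝ → M, c 0 = m ∧ c 1 = m' ∧ MapsTo c (Icc 0 1) O ∧ IsTangentOn Δ c (Icc 0 1)

variable [IsManifold 𝓘(ℝ, E) ∞ M]

theorem hasDerivWithinAt_chart_comp {m₀ : M} {c : ℝ → M} {s : Set ℝ} {t : ℝ}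
    {c' : TangentSpace 𝓘(ℝ, ℝ) t →L[ℝ] TangentSpace 𝓘(ℝ, E) (c t)}
    (hc : c t ∈ (extChartAt 𝓘(ℝ, E) m₀).source)
    (hd : HasMFDerivWithinAt 𝓘(ℝ, ℝ) 𝓘(ℝ, E) c s t c') :
    HasDerivWithinAt (fun t ↦ extChartAt 𝓘(ℝ, E) m₀ (c t))
      (mfderiv 𝓘(ℝ, E) 𝓘(ℝ, E) (extChartAt 𝓘(ℝ, E) m₀) (c t) (c' (1 : ℝ)) : E) s t := by
  let A : ℝ →L[ℝ] E :=
    (mfderiv 𝓘(ℝ, E) 𝓘(ℝ, E) (extChartAt 𝓘(ℝ, E) m₀) (c t)).comp c'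
  have h : HasFDerivWithinAt (fun t ↦ extChartAt 𝓘(ℝ, E) m₀ (c t)) A s t :=
    ((mdifferentiableAt_chart hc).hasMFDerivAt.comp_hasMFDerivWithinAt t hd).hasFDerivWithinAt
  exact h.hasDerivWithinAt

theorem hasMFDerivAt_chart_symm_comp {m₀ : M} {c : ℝ → E} {t : ℝ} {c' : E}
    (hc : c t ∈ (extChartAt 𝓘(ℝ, E) m₀).target) (hd : HasDerivAt c c' t) :
    ∃ d : TangentSpace 𝓘(ℝ, ℝ) t →L[ℝ]
        TangentSpace 𝓘(ℝ, E) ((extChartAt 𝓘(ℝ, E) m₀).symm (c t)),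
      HasMFDerivAt 𝓘(ℝ, ℝ) 𝓘(ℝ, E) (fun t ↦ (extChartAt 𝓘(ℝ, E) m₀).symm (c t)) t d ∧
      d (1 : ℝ) = mfderiv 𝓘(ℝ, E) 𝓘(ℝ, E) (extChartAt 𝓘(ℝ, E) m₀).symm (c t) c' := by
  refine ⟨_, (mdifferentiableAt_chart_symm hc).hasMFDerivAt.comp t hd.hasFDerivAt.hasMFDerivAt, ?_⟩
  exact congrArg (mfderiv 𝓘(ℝ, E) 𝓘(ℝ, E) (extChartAt 𝓘(ℝ, E) m₀).symm (c t)) (one_smul ℝ c')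

namespace IsNormalizedFrame

variable [CompleteSpace E] {Δ : ∀ m : M, Submodule ℝ (TangentSpace 𝓘(ℝ, E) m)} {m₀ : M}
  {N : E → E₁ →L[ℝ] E} {ℓ : E →L[ℝ] E₁} {ρ : ℝ} {L K C : ℝ≥0}
  (h : IsNormalizedFrame Δ m₀ N ℓ (ball (extChartAt 𝓘(ℝ, E) m₀ m₀) ρ))
  (hN : CommutingFrame N ℓ (extChartAt 𝓘(ℝ, E) m₀ m₀) ρ L K C)
include h

theorem exists_curve {m : M} (hm : m ∈ (extChartAt 𝓘(ℝ, E) m₀).source)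
    (hmu : extChartAt 𝓘(ℝ, E) m₀ m ∈ hN.core) {O : Set M} (hO : O ∈ 𝓝 m) :
    ∃ u ∈ 𝓝 m, ∀ m' ∈ u,
      hN.label (extChartAt 𝓘(ℝ, E) m₀ m') = hN.label (extChartAt 𝓘(ℝ, E) m₀ m) →
      ∃ c : ℝ → M, c 0 = m ∧ c 1 = m' ∧ MapsTo c (Icc 0 1) O ∧ IsTangentOn Δ c (Icc 0 1) := by
  let φ := extChartAt 𝓘(ℝ, E) m₀
  have hO' : φ.symm ⁻¹' O ∩ ball (φ m₀) ρ ∈ 𝓝 (φ m) := by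
    refine Filter.inter_mem ?_ (isOpen_ball.mem_nhds (hN.core_subset_ball hmu))
    exact (contMDiffAt_chart_symm (φ.map_source hm)).continuousAt.preimage_mem_nhds
      (by rwa [φ.left_inv hm])
  obtain ⟨w, hw, hcurve⟩ := hN.exists_tangent_curve hmu hO'
  refine ⟨φ.source ∩ φ ⁻¹' w, Filter.inter_mem ((isOpen_extChartAt_source m₀).mem_nhds hm)
    ((continuousAt_extChartAt' hm).preimage_mem_nhds hw), fun m' hm' hl ↦ ?_⟩
  obtain ⟨c, a, c_zero, c_one, hc⟩ := hcurve (φ m') hm'.2 hl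
  refine ⟨fun t ↦ φ.symm (c t), (congrArg φ.symm c_zero).trans (φ.left_inv hm),
    (congrArg φ.symm c_one).trans (φ.left_inv hm'.1), fun t ht ↦ (hc t ht).1.1, fun t ht ↦ ?_⟩
  have hct := (hc t ht).1.2
  obtain ⟨d, hd, d_one⟩ := hasMFDerivAt_chart_symm_comp (h.subset_target hct) (hc t ht).2
  exact ⟨d, hd.hasMFDerivWithinAt, d_one ▸ h.mfderiv_chart_symm_mem hct a⟩

/-- The leaf chart of `Δ` defined by a normalized frame which commutes. -/
def leafChart : LeafChart Δ where
  source := (extChartAt 𝓘(ℝ, E) m₀).source ∩ extChartAt 𝓘(ℝ, E) m₀ ⁻¹' hN.core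
  label m := hN.label (extChartAt 𝓘(ℝ, E) m₀ m)
  isOpen := isOpen_inter_preimage_chart m₀ hN.isOpen_core
  continuousOn _ hm := ((hN.continuousAt_label hm.2).comp
    (continuousAt_extChartAt' hm.1)).continuousWithinAt
  hasDerivWithinAt {c _ _ _} hc hd hc' :=
    hN.hasDerivWithinAt_label (c := fun t ↦ extChartAt 𝓘(ℝ, E) m₀ (c t)) hc.2
      (hasDerivWithinAt_chart_comp hc.1 hd)
      ((h.mem_iff _ hc.1 (hN.core_subset_ball hc.2) _).1 hc')
  tangent {c _ _} hc hd hl :=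
    (h.mem_iff _ hc.1 (hN.core_subset_ball hc.2) _).2 <|
      hN.apply_proj_eq_of_label_eq (c := fun t ↦ extChartAt 𝓘(ℝ, E) m₀ (c t)) hc.2
        (hasDerivWithinAt_univ.1
          (hasDerivWithinAt_chart_comp hc.1 hd.hasMFDerivWithinAt)) hl
  exists_curve _ hm _ hO := h.exists_curve hN hm.1 hm.2 hO

end IsNormalizedFrame

theorem exists_leafChart [FiniteDimensional ℝ E]
    {Δ : ∀ m : M, Submodule ℝ (TangentSpace 𝓘(ℝ, E) m)} (hΔ : IsDistribution Δ)
    (hI : IsInvolutive Δ) (m₀ : M) : ∃ L : LeafChart Δ, m₀ ∈ L.source := by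
  have : CompleteSpace E := FiniteDimensional.complete ℝ E
  obtain ⟨k, N₀, ℓ, u, h₀⟩ := exists_isNormalizedFrame hΔ m₀
  have hu := h₀.isOpen.mem_nhds h₀.mem
  obtain ⟨N, ρ, L, K, C, hN, hsub, heq⟩ := exists_commutingFrame_eventuallyEq
    ((h₀.contDiffAt h₀.mem).of_le ENat.LEInfty.out) (Filter.mem_of_superset hu h₀.left_inv)
    (Filter.mem_of_superset hu fun y hy ↦ h₀.comm hI hy) hu
  have h : IsNormalizedFrame Δ m₀ N ℓ (ball (extChartAt 𝓘(ℝ, E) m₀ m₀) ρ) :=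
    h₀.congr isOpen_ball (mem_ball_self hN.radius_pos) hsub heq
  exact ⟨h.leafChart hN, mem_extChartAt_source m₀, hN.mem_core⟩

end LeafCharts

/-! ### Leaves -/

section Leaves

open Metric Set

variable {E : Type*} [NormedAddCommGroup E] [NormedSpace ℝ E]
  {M : Type*} [TopologicalSpace M] [ChartedSpace E M]
  {Δ : ∀ m : M, Submodule ℝ (TangentSpace 𝓘(ℝ, E) m)}

theorem IsTangentOn.mono {c : ℝ → M} {s s' : Set ℝ} (h : IsTangentOn Δ c s) (hs : s' ⊆ s) :
    IsTangentOn Δ c s' := fun t ht ↦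
  let ⟨c', hd, hc'⟩ := h t (hs ht)
  ⟨c', hd.mono hs, hc'⟩

theorem LeafChart.label_eq_of_isTangentOn (L : LeafChart Δ) {c : ℝ → M} {a b : ℝ} (hab : a ≤ b)
    (hc : IsTangentOn Δ c (Icc a b)) (hs : MapsTo c (Icc a b) L.source) :
    L.label (c a) = L.label (c b) := by
  have hderiv : ∀ t ∈ Icc a b, HasDerivWithinAt (fun t ↦ L.label (c t)) 0 (Icc a b) t :=
    fun t ht ↦
      let ⟨_, hd, hc'⟩ := hc t ht
      L.hasDerivWithinAt (hs ht) hd hc'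
  have h := norm_image_sub_le_of_norm_deriv_le_segment' (C := 0) hderiv (by simp) b ⟨hab, le_rfl⟩
  simp only [zero_mul, norm_le_zero_iff, sub_eq_zero] at h
  exact h.symm

theorem LeafChart.eventually_label_eq (L L' : LeafChart Δ) {m : M} (hm : m ∈ L.source)
    (hm' : m ∈ L'.source) :
    ∀ᶠ x in 𝓝 m, L.label x = L.label m → L'.label x = L'.label m := by
  obtain ⟨u, hu, hcurve⟩ := L.exists_curve m hm L'.source (L'.isOpen.mem_nhds hm')
  filter_upwards [hu] with x hx hlabel
  obtain ⟨c, rfl, rfl, hmaps, htangent⟩ := hcurve x hx hlabel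
  exact (L'.label_eq_of_isTangentOn zero_le_one htangent hmaps).symm

theorem LeafChart.countable_label_image [SecondCountableTopology M] (L L' : LeafChart Δ) (z : E) :
    (L'.label '' {m | m ∈ L.source ∧ m ∈ L'.source ∧ L.label m = z}).Countable := by
  set P := {m | m ∈ L.source ∧ m ∈ L'.source ∧ L.label m = z}
  have hconst : ∀ m ∈ P, {x | L'.label x = L'.label m} ∈ 𝓝[P] m := by
    intro m hm
    filter_upwards [mem_nhdsWithin_of_mem_nhds (L.eventually_label_eq L' hm.1 hm.2.1),
      self_mem_nhdsWithin] with x hx hxP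
    exact hx (hxP.2.2.trans hm.2.2.symm)
  obtain ⟨t, -, t_countable, hcover⟩ := TopologicalSpace.countable_cover_nhdsWithin hconst
  refine (t_countable.image L'.label).mono ?_
  rintro _ ⟨m, hm, rfl⟩
  obtain ⟨m₁, hm₁, hlabel⟩ := mem_iUnion₂.1 (hcover hm)
  exact ⟨m₁, hm₁, Eq.symm hlabel⟩

/-- The local leaves, given by a leaf chart and a label, that are met by a chain of `n` local leaves
starting from the local leaf `p`. -/
def leafChain {ι : Type*} (L : ι → LeafChart Δ) (p : ι × E) : ℕ → Set (ι × E)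
  | 0 => {p}
  | n + 1 => ⋃ q ∈ leafChain L p n, ⋃ j, (fun z ↦ (j, z)) ''
      ((L j).label '' {m | m ∈ (L q.1).source ∧ m ∈ (L j).source ∧ (L q.1).label m = q.2})

/-- The union of the local leaves that can be joined to the local leaf `p` by a chain of local
leaves. -/
def leaf {ι : Type*} (L : ι → LeafChart Δ) (p : ι × E) : Set M :=
  {m | ∃ i n, m ∈ (L i).source ∧ (i, (L i).label m) ∈ leafChain L p n}

variable {ι : Type*}

theorem mem_leaf_iff (L : ι → LeafChart Δ) (p : ι × E) {i : ι} {m : M}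
    (hm : m ∈ (L i).source) : m ∈ leaf L p ↔ ∃ n, (i, (L i).label m) ∈ leafChain L p n := by
  refine ⟨fun ⟨j, n, hj, hn⟩ ↦ ⟨n + 1, ?_⟩, fun ⟨n, hn⟩ ↦ ⟨i, n, hm, hn⟩⟩
  exact mem_biUnion hn (mem_iUnion.2 ⟨i, _, ⟨m, ⟨hj, hm, rfl⟩, rfl⟩, rfl⟩)

theorem IsTangentOn.mem_leaf_iff {L : ι → LeafChart Δ} (hL : ∀ m, ∃ i, m ∈ (L i).source)
    (p : ι × E) {c : ℝ → M} {a b : ℝ} (hab : a ≤ b) (hc : IsTangentOn Δ c (Icc a b)) :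
    c a ∈ leaf L p ↔ c b ∈ leaf L p := by
  refine isPreconnected_Icc.induction₂ (s := Icc a b) (fun s t ↦ c s ∈ leaf L p ↔ c t ∈ leaf L p)
    (fun s hs ↦ ?_) (fun _ _ _ _ _ _ ↦ Iff.trans) (fun _ _ _ _ ↦ Iff.symm)
    (left_mem_Icc.2 hab) (right_mem_Icc.2 hab)
  obtain ⟨i, hi⟩ := hL (c s)
  obtain ⟨c', hd, -⟩ := hc s hs
  obtain ⟨ε, hε, hball⟩ := Metric.mem_nhdsWithin_iff.1
    (hd.continuousWithinAt.preimage_mem_nhdsWithin ((L i).isOpen.mem_nhds hi))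
  filter_upwards [inter_mem_nhdsWithin (Icc a b) (ball_mem_nhds s hε)] with t ht
  have hsub : uIcc s t ⊆ ball s ε ∩ Icc a b := by
    refine subset_inter ?_ (ordConnected_Icc.uIcc_subset hs ht.1)
    rw [← segment_eq_uIcc]
    exact (convex_ball s ε).segment_subset (mem_ball_self hε) ht.2
  have hlabel : (L i).label (c s) = (L i).label (c t) := by
    have htangent := hc.mono (hsub.trans inter_subset_right)
    have hmaps : MapsTo c (uIcc s t) (L i).source := fun r hr ↦ hball (hsub hr)
    rcases le_total s t with h | h
    · rw [uIcc_of_le h] at htangent hmaps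
      exact (L i).label_eq_of_isTangentOn h htangent hmaps
    · rw [uIcc_of_ge h] at htangent hmaps
      exact ((L i).label_eq_of_isTangentOn h htangent hmaps).symm
  rw [DiscreteMechanics.mem_leaf_iff L p hi,
    DiscreteMechanics.mem_leaf_iff L p (hball ⟨ht.2, ht.1⟩), hlabel]

theorem Reachable.mem_leaf_iff {L : ι → LeafChart Δ} (hL : ∀ m, ∃ i, m ∈ (L i).source)
    (p : ι × E) {m m' : M} (h : Reachable Δ m m') : m ∈ leaf L p ↔ m' ∈ leaf L p := by
  obtain ⟨c, n, t, rfl, rfl, hc⟩ := h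
  have hleaf : ∀ k ≤ n, (c (t 0) ∈ leaf L p ↔ c (t k) ∈ leaf L p) := by
    intro k
    induction k with
    | zero => exact fun _ ↦ Iff.rfl
    | succ k ih =>
      intro hk
      obtain ⟨hlt, hsmooth, hd⟩ := hc k (by omega)
      refine (ih (by omega)).trans (IsTangentOn.mem_leaf_iff hL p hlt.le fun s hs ↦ ?_)
      exact ⟨_, ((hsmooth s hs).mdifferentiableWithinAt (by simp)).hasMFDerivWithinAt, hd s hs⟩
  exact hleaf n le_rfl

section SecondCountable

variable [SecondCountableTopology M]

theorem countable_leafChain [Countable ι] (L : ι → LeafChart Δ) (p : ι × E) (n : ℕ) :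
    (leafChain L p n).Countable := by
  induction n with
  | zero => exact countable_singleton p
  | succ n ih => exact ih.biUnion fun q _ ↦ countable_iUnion fun j ↦
      ((L q.1).countable_label_image (L j) q.2).image _

theorem countable_label_leaf [Countable ι] (L : ι → LeafChart Δ) (p : ι × E) (i : ι) :
    ((L i).label '' ((L i).source ∩ leaf L p)).Countable := by
  refine ((countable_iUnion (countable_leafChain L p)).image Prod.snd).mono ?_
  rintro _ ⟨m, ⟨hm, hleaf⟩, rfl⟩
  obtain ⟨n, hn⟩ := (mem_leaf_iff L p hm).1 hleaf
  exact ⟨_, mem_iUnion.2 ⟨n, hn⟩, rfl⟩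

theorem tangent_of_eventually_mem_leaf [Countable ι] {L : ι → LeafChart Δ}
    (hL : ∀ m, ∃ i, m ∈ (L i).source) (p : ι × E) {c : ℝ → M} {t : ℝ}
    {c' : TangentSpace 𝓘(ℝ, ℝ) t →L[ℝ] TangentSpace 𝓘(ℝ, E) (c t)}
    (hd : HasMFDerivAt 𝓘(ℝ, ℝ) 𝓘(ℝ, E) c t c')
    (hc : ∀ᶠ s in 𝓝 t, ContinuousAt c s ∧ c s ∈ leaf L p) : c' (1 : ℝ) ∈ Δ (c t) := by
  obtain ⟨i, hi⟩ := hL (c t)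
  obtain ⟨ε, hε, hball⟩ := eventually_nhds_iff_ball.1
    ((hd.continuousAt.eventually ((L i).isOpen.mem_nhds hi)).and hc)
  have hcont : ContinuousOn (fun s ↦ (L i).label (c s)) (ball t ε) := fun s hs ↦
    (((L i).continuousOn.continuousAt ((L i).isOpen.mem_nhds (hball s hs).1)).comp
      (hball s hs).2.1).continuousWithinAt
  have himage : (fun s ↦ (L i).label (c s)) '' ball t ε ⊆
      (L i).label '' ((L i).source ∩ leaf L p) := by
    rintro _ ⟨s, hs, rfl⟩
    exact ⟨c s, ⟨(hball s hs).1, (hball s hs).2.2⟩, rfl⟩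
  refine (L i).tangent hi hd ?_
  filter_upwards [ball_mem_nhds t hε] with s hs
  exact (countable_label_leaf L p i).isTotallyDisconnected _ himage
    ((convex_ball t ε).isPreconnected.image _ hcont) (mem_image_of_mem _ hs)
    (mem_image_of_mem _ (mem_ball_self hε))

variable [FiniteDimensional ℝ E] [IsManifold 𝓘(ℝ, E) ∞ M]

theorem exists_countable_leafCharts (hΔ : IsDistribution Δ) (hI : IsInvolutive Δ) :
    ∃ (T : Set M) (L : T → LeafChart Δ), T.Countable ∧ ∀ m, ∃ i, m ∈ (L i).source := by
  choose L hL using exists_leafChart hΔ hI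
  obtain ⟨T, hT, hcover⟩ := TopologicalSpace.countable_cover_nhds
    fun m ↦ (L m).isOpen.mem_nhds (hL m)
  refine ⟨T, fun m ↦ L m, hT, fun m ↦ ?_⟩
  obtain ⟨x, hx, hm⟩ := mem_iUnion₂.1 (hcover.symm ▸ mem_univ m : m ∈ ⋃ x ∈ T, (L x).source)
  exact ⟨⟨x, hx⟩, hm⟩

theorem tangent_of_forall_reachable (hΔ : IsDistribution Δ) (hI : IsInvolutive Δ) {b c : ℝ → M}
    {ε : ℝ} (hε : 0 < ε) (hc : IsTangentOn Δ c (Ioo (-ε) ε)) (hb : ContinuousOn b (Ioo (-ε) ε))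
    {b' : TangentSpace 𝓘(ℝ, ℝ) (0 : ℝ) →L[ℝ] TangentSpace 𝓘(ℝ, E) (b 0)}
    (hd : HasMFDerivAt 𝓘(ℝ, ℝ) 𝓘(ℝ, E) b 0 b')
    (h : ∀ t ∈ Ioo (-ε) ε, Reachable Δ (c t) (b t)) : b' (1 : ℝ) ∈ Δ (b 0) := by
  obtain ⟨T, L, hT, hL⟩ := exists_countable_leafCharts hΔ hI
  have := hT.to_subtype
  obtain ⟨i, hi⟩ := hL (c 0)
  let p : T × E := (i, (L i).label (c 0))
  have hp : c 0 ∈ leaf L p := (mem_leaf_iff L p hi).2 ⟨0, rfl⟩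
  have h0 : (0 : ℝ) ∈ Ioo (-ε) ε := ⟨by linarith, hε⟩
  refine tangent_of_eventually_mem_leaf hL p hd ?_
  filter_upwards [isOpen_Ioo.mem_nhds h0] with t ht
  refine ⟨hb.continuousAt (isOpen_Ioo.mem_nhds ht), ((h t ht).mem_leaf_iff hL p).1 ?_⟩
  rcases le_total 0 t with hle | hle
  · exact (IsTangentOn.mem_leaf_iff hL p hle (hc.mono (ordConnected_Ioo.out h0 ht))).1 hp
  · exact (IsTangentOn.mem_leaf_iff hL p hle (hc.mono (ordConnected_Ioo.out ht h0))).2 hp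

end SecondCountable

end Leaves

/-! ### Submersions and distributions -/

theorem exists_contDiffAt_lift {P F E : Type*} [NormedAddCommGroup P] [NormedSpace ℝ P]
    [NormedAddCommGroup F] [NormedSpace ℝ F] [NormedAddCommGroup E] [NormedSpace ℝ E]
    [FiniteDimensional ℝ E] {n : WithTop ℕ∞} {A : P → F →L[ℝ] E} {Z : P → E} {p₀ : P}
    (hA : ContDiffAt ℝ n A p₀) (hZ : ContDiffAt ℝ n Z p₀) (hs : Function.Surjective (A p₀)) {w : F}
    (hw : A p₀ w = Z p₀) :
    ∃ Y : P → F, ContDiffAt ℝ n Y p₀ ∧ Y p₀ = w ∧ ∀ᶠ p in 𝓝 p₀, A p (Y p) = Z p := by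
  have : CompleteSpace E := FiniteDimensional.complete ℝ E
  obtain ⟨s₀, hs₀⟩ := (A p₀).toLinearMap.exists_rightInverse_of_surjective
    (LinearMap.range_eq_top.2 hs)
  let s : E →L[ℝ] F := LinearMap.toContinuousLinearMap s₀
  let G : P → E →L[ℝ] E := fun p ↦ A p ∘L s
  have hG₀ : G p₀ = 1 := ContinuousLinearMap.ext (LinearMap.congr_fun hs₀)
  have hG : ContDiffAt ℝ n G p₀ := hA.clm_comp contDiffAt_const
  have hinv : ContDiffAt ℝ n (fun p ↦ Ring.inverse (G p)) p₀ := by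
    have h := contDiffAt_ringInverse ℝ (n := n) (1 : (E →L[ℝ] E)ˣ)
    rw [Units.val_one, ← hG₀] at h
    exact h.comp p₀ hG
  refine ⟨fun p ↦ w + s (Ring.inverse (G p) (Z p - A p w)), ?_, by simp [hw], ?_⟩
  · exact contDiffAt_const.add (s.contDiff.contDiffAt.comp p₀
      (hinv.clm_apply (hZ.sub (hA.clm_apply contDiffAt_const))))
  · have hunit : ∀ᶠ p in 𝓝 p₀, IsUnit (G p) :=
      hG.continuousAt.eventually (Units.isOpen.mem_nhds (by simp [hG₀]))
    filter_upwards [hunit] with p hp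
    have h : A p (s (Ring.inverse (G p) (Z p - A p w))) = Z p - A p w :=
      DFunLike.congr_fun (Ring.mul_inverse_cancel (G p) hp) _
    rw [map_add, h, add_sub_cancel]

section LocalRepresentatives

open Set

variable {E : Type*} [NormedAddCommGroup E] [NormedSpace ℝ E]
  {M : Type*} [TopologicalSpace M] [ChartedSpace E M]
  {F : Type*} [NormedAddCommGroup F] [NormedSpace ℝ F]
  {D : Type*} [TopologicalSpace D] [ChartedSpace F D]

theorem mfderiv_apply_congr (g : D → M) {x x' : D} (h : x = x') {v v' : F} (hv : v = v') :
    (mfderiv 𝓘(ℝ, F) 𝓘(ℝ, E) g x v : E) = mfderiv 𝓘(ℝ, F) 𝓘(ℝ, E) g x' v' := by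
  subst h hv
  rfl

theorem eventually_chart_symm {x : D} {p : D → Prop} (hp : ∀ᶠ z in 𝓝 x, p z) :
    ∀ᶠ y in 𝓝 (extChartAt 𝓘(ℝ, F) x x),
      y ∈ (extChartAt 𝓘(ℝ, F) x).target ∧ p ((extChartAt 𝓘(ℝ, F) x).symm y) := by
  refine Filter.Eventually.and (extChartAt_target_mem_nhds x)
    ((continuousAt_extChartAt_symm x).eventually ?_)
  rwa [extChartAt_to_inv]

theorem writtenInExtChartAt_self (g : D → M) (x : D) :
    writtenInExtChartAt 𝓘(ℝ, F) 𝓘(ℝ, E) x g (extChartAt 𝓘(ℝ, F) x x) =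
      extChartAt 𝓘(ℝ, E) (g x) (g x) :=
  congrArg (fun z ↦ extChartAt 𝓘(ℝ, E) (g x) (g z)) (extChartAt_to_inv x)

variable [IsManifold 𝓘(ℝ, E) ∞ M] [IsManifold 𝓘(ℝ, F) ∞ D] {g : D → M} {x : D}

section Pointwise

variable {y : F} (hy : y ∈ (extChartAt 𝓘(ℝ, F) x).target)
  (hs : g ((extChartAt 𝓘(ℝ, F) x).symm y) ∈ (extChartAt 𝓘(ℝ, E) (g x)).source)
include hy hs

theorem contDiffAt_writtenInExtChartAt
    (hg : ContMDiffAt 𝓘(ℝ, F) 𝓘(ℝ, E) ∞ g ((extChartAt 𝓘(ℝ, F) x).symm y)) :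
    ContDiffAt ℝ ∞ (writtenInExtChartAt 𝓘(ℝ, F) 𝓘(ℝ, E) x g) y :=
  contMDiffAt_iff_contDiffAt.1
    ((contMDiffAt_chart hs).comp y (hg.comp y (contMDiffAt_chart_symm hy)))

variable (hg : MDifferentiableAt 𝓘(ℝ, F) 𝓘(ℝ, E) g ((extChartAt 𝓘(ℝ, F) x).symm y))
include hg

theorem fderiv_writtenInExtChartAt (k : F) :
    fderiv ℝ (writtenInExtChartAt 𝓘(ℝ, F) 𝓘(ℝ, E) x g) y k =
      mfderiv 𝓘(ℝ, E) 𝓘(ℝ, E) (extChartAt 𝓘(ℝ, E) (g x)) (g ((extChartAt 𝓘(ℝ, F) x).symm y))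
        (mfderiv 𝓘(ℝ, F) 𝓘(ℝ, E) g ((extChartAt 𝓘(ℝ, F) x).symm y)
          (mfderiv 𝓘(ℝ, F) 𝓘(ℝ, F) (extChartAt 𝓘(ℝ, F) x).symm y k)) := by
  let A : F →L[ℝ] E := (mfderiv 𝓘(ℝ, E) 𝓘(ℝ, E) (extChartAt 𝓘(ℝ, E) (g x))
    (g ((extChartAt 𝓘(ℝ, F) x).symm y))).comp
      ((mfderiv 𝓘(ℝ, F) 𝓘(ℝ, E) g ((extChartAt 𝓘(ℝ, F) x).symm y)).comp
        (mfderiv 𝓘(ℝ, F) 𝓘(ℝ, F) (extChartAt 𝓘(ℝ, F) x).symm y))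
  have h : HasFDerivAt (writtenInExtChartAt 𝓘(ℝ, F) 𝓘(ℝ, E) x g) A y :=
    ((mdifferentiableAt_chart hs).hasMFDerivAt.comp y
      (hg.hasMFDerivAt.comp y (mdifferentiableAt_chart_symm hy).hasMFDerivAt)).hasFDerivAt
  exact DFunLike.congr_fun h.fderiv k

theorem mfderiv_eq_iff_fderiv_writtenInExtChartAt_eq (j k : F) :
    mfderiv 𝓘(ℝ, F) 𝓘(ℝ, E) g ((extChartAt 𝓘(ℝ, F) x).symm y)
        (mfderiv 𝓘(ℝ, F) 𝓘(ℝ, F) (extChartAt 𝓘(ℝ, F) x).symm y j) =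
      mfderiv 𝓘(ℝ, F) 𝓘(ℝ, E) g ((extChartAt 𝓘(ℝ, F) x).symm y)
        (mfderiv 𝓘(ℝ, F) 𝓘(ℝ, F) (extChartAt 𝓘(ℝ, F) x).symm y k) ↔
      fderiv ℝ (writtenInExtChartAt 𝓘(ℝ, F) 𝓘(ℝ, E) x g) y j =
        fderiv ℝ (writtenInExtChartAt 𝓘(ℝ, F) 𝓘(ℝ, E) x g) y k := by
  rw [fderiv_writtenInExtChartAt hy hs hg, fderiv_writtenInExtChartAt hy hs hg]
  exact (mfderiv_chart_injective hs).eq_iff.symm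

end Pointwise

theorem contDiffAt_writtenInExtChartAt_self (hg : ContMDiffAt 𝓘(ℝ, F) 𝓘(ℝ, E) ∞ g x) :
    ContDiffAt ℝ ∞ (writtenInExtChartAt 𝓘(ℝ, F) 𝓘(ℝ, E) x g) (extChartAt 𝓘(ℝ, F) x x) := by
  have hx : (extChartAt 𝓘(ℝ, F) x).symm (extChartAt 𝓘(ℝ, F) x x) = x := extChartAt_to_inv x
  exact contDiffAt_writtenInExtChartAt (mem_extChartAt_target x)
    (by rw [hx]; exact mem_extChartAt_source _) (by rwa [hx])

theorem fderiv_writtenInExtChartAt_self (hg : MDifferentiableAt 𝓘(ℝ, F) 𝓘(ℝ, E) g x)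
    (v : TangentSpace 𝓘(ℝ, F) x) :
    fderiv ℝ (writtenInExtChartAt 𝓘(ℝ, F) 𝓘(ℝ, E) x g) (extChartAt 𝓘(ℝ, F) x x)
      (mfderiv 𝓘(ℝ, F) 𝓘(ℝ, F) (extChartAt 𝓘(ℝ, F) x) x v) =
      mfderiv 𝓘(ℝ, E) 𝓘(ℝ, E) (extChartAt 𝓘(ℝ, E) (g x)) (g x)
        (mfderiv 𝓘(ℝ, F) 𝓘(ℝ, E) g x v) := by
  have hx : (extChartAt 𝓘(ℝ, F) x).symm (extChartAt 𝓘(ℝ, F) x x) = x := extChartAt_to_inv x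
  refine (fderiv_writtenInExtChartAt (mem_extChartAt_target x)
    (by rw [hx]; exact mem_extChartAt_source _) (by rwa [hx]) _).trans ?_
  refine mfderiv_apply_congr _ (by rw [hx]) (mfderiv_apply_congr _ hx ?_)
  exact mfderiv_chart_symm_mfderiv_chart (mem_extChartAt_source x) v

theorem surjective_fderiv_writtenInExtChartAt (hg : MDifferentiableAt 𝓘(ℝ, F) 𝓘(ℝ, E) g x)
    (hsurj : Function.Surjective (mfderiv 𝓘(ℝ, F) 𝓘(ℝ, E) g x)) :
    Function.Surjective
      (fderiv ℝ (writtenInExtChartAt 𝓘(ℝ, F) 𝓘(ℝ, E) x g) (extChartAt 𝓘(ℝ, F) x x)) := by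
  intro e
  obtain ⟨e', he'⟩ := (isInvertible_mfderiv_extChartAt (I := 𝓘(ℝ, E))
    (mem_extChartAt_source (g x))).surjective e
  obtain ⟨v, rfl⟩ := hsurj e'
  exact ⟨_, (fderiv_writtenInExtChartAt_self hg v).trans he'⟩

end LocalRepresentatives

section Lifts

open Set

variable {E₁ F E : Type*} [NormedAddCommGroup E₁] [NormedSpace ℝ E₁]
  [NormedAddCommGroup F] [NormedSpace ℝ F] [NormedAddCommGroup E] [NormedSpace ℝ E]
  {M : Type*} [TopologicalSpace M] [ChartedSpace E M]
  {D : Type*} [TopologicalSpace D] [ChartedSpace F D]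
  {Δ : ∀ m : M, Submodule ℝ (TangentSpace 𝓘(ℝ, E) m)} {g : D → M} {x : D}

theorem IsNormalizedFrame.eventually_mem_preimage {N : E → E₁ →L[ℝ] E} {ℓ : E →L[ℝ] E₁}
    {u : Set E} (h : IsNormalizedFrame Δ (g x) N ℓ u) (hg : ContinuousAt g x) :
    ∀ᶠ z in 𝓝 x, g z ∈ (extChartAt 𝓘(ℝ, E) (g x)).source ∧ extChartAt 𝓘(ℝ, E) (g x) (g z) ∈ u :=
  hg.eventually (Filter.Eventually.and (extChartAt_source_mem_nhds (g x))
    ((continuousAt_extChartAt (g x)).eventually (h.isOpen.mem_nhds h.mem)))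

variable [IsManifold 𝓘(ℝ, E) ∞ M] [IsManifold 𝓘(ℝ, F) ∞ D]

namespace IsNormalizedFrame

variable {N : E → E₁ →L[ℝ] E} {ℓ : E →L[ℝ] E₁} {u : Set E}
  (h : IsNormalizedFrame Δ (g x) N ℓ u)
include h

theorem mfderiv_mem_iff {y : F} (hy : y ∈ (extChartAt 𝓘(ℝ, F) x).target)
    (hs : g ((extChartAt 𝓘(ℝ, F) x).symm y) ∈ (extChartAt 𝓘(ℝ, E) (g x)).source)
    (hu : writtenInExtChartAt 𝓘(ℝ, F) 𝓘(ℝ, E) x g y ∈ u)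
    (hg : MDifferentiableAt 𝓘(ℝ, F) 𝓘(ℝ, E) g ((extChartAt 𝓘(ℝ, F) x).symm y)) (k : F) :
    mfderiv 𝓘(ℝ, F) 𝓘(ℝ, E) g ((extChartAt 𝓘(ℝ, F) x).symm y)
        (mfderiv 𝓘(ℝ, F) 𝓘(ℝ, F) (extChartAt 𝓘(ℝ, F) x).symm y k) ∈
        Δ (g ((extChartAt 𝓘(ℝ, F) x).symm y)) ↔
      N (writtenInExtChartAt 𝓘(ℝ, F) 𝓘(ℝ, E) x g y)
          (ℓ (fderiv ℝ (writtenInExtChartAt 𝓘(ℝ, F) 𝓘(ℝ, E) x g) y k)) =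
        fderiv ℝ (writtenInExtChartAt 𝓘(ℝ, F) 𝓘(ℝ, E) x g) y k :=
  h.mem_iff_of_mfderiv_eq hs hu (fderiv_writtenInExtChartAt hy hs hg k).symm

theorem exists_lift_field [FiniteDimensional ℝ E] (hg : ContMDiffAt 𝓘(ℝ, F) 𝓘(ℝ, E) ∞ g x)
    (hsurj : Function.Surjective (mfderiv 𝓘(ℝ, F) 𝓘(ℝ, E) g x)) {w : TangentSpace 𝓘(ℝ, F) x}
    (hw : mfderiv 𝓘(ℝ, F) 𝓘(ℝ, E) g x w ∈ Δ (g x)) :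
    ∃ (Y : F → F) (a : E₁), ContDiffAt ℝ 1 Y (extChartAt 𝓘(ℝ, F) x x) ∧
      Y (extChartAt 𝓘(ℝ, F) x x) =
        mfderiv 𝓘(ℝ, F) 𝓘(ℝ, F) (extChartAt 𝓘(ℝ, F) x) x w ∧
      ∀ᶠ y in 𝓝 (extChartAt 𝓘(ℝ, F) x x),
        fderiv ℝ (writtenInExtChartAt 𝓘(ℝ, F) 𝓘(ℝ, E) x g) y (Y y) =
          N (writtenInExtChartAt 𝓘(ℝ, F) 𝓘(ℝ, E) x g y) a := by
  have hgd : MDifferentiableAt 𝓘(ℝ, F) 𝓘(ℝ, E) g x := hg.mdifferentiableAt (by simp)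
  have hf := contDiffAt_writtenInExtChartAt_self hg
  have hfx := writtenInExtChartAt_self (E := E) (F := F) g x
  let a : E₁ := ℓ (mfderiv 𝓘(ℝ, E) 𝓘(ℝ, E) (extChartAt 𝓘(ℝ, E) (g x)) (g x)
    (mfderiv 𝓘(ℝ, F) 𝓘(ℝ, E) g x w))
  have hN : ContDiffAt ℝ 1 (fun y ↦ N (writtenInExtChartAt 𝓘(ℝ, F) 𝓘(ℝ, E) x g y) a)
      (extChartAt 𝓘(ℝ, F) x x) := by
    refine (ContDiffAt.comp _ ?_ (hf.of_le ENat.LEInfty.out)).clm_apply contDiffAt_const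
    rw [hfx]
    exact (h.contDiffAt h.mem).of_le ENat.LEInfty.out
  obtain ⟨Y, hY, hYx, hlift⟩ := exists_contDiffAt_lift
    ((hf.of_le (m := 2) ENat.LEInfty.out).fderiv_right (m := 1) (by norm_num)) hN
    (surjective_fderiv_writtenInExtChartAt hgd hsurj)
    (((fderiv_writtenInExtChartAt_self hgd w).trans
      ((h.mem_iff _ (mem_extChartAt_source _) h.mem _).1 hw).symm).trans
      (congrArg (fun z ↦ N z a) hfx.symm))
  exact ⟨Y, a, hY, hYx, hlift⟩

end IsNormalizedFrame

theorem exists_lift_curve [FiniteDimensional ℝ E] [CompleteSpace F] (hΔ : IsDistribution Δ)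
    (hg : ContMDiff 𝓘(ℝ, F) 𝓘(ℝ, E) ∞ g)
    (hsurj : Function.Surjective (mfderiv 𝓘(ℝ, F) 𝓘(ℝ, E) g x)) {w : TangentSpace 𝓘(ℝ, F) x}
    (hw : mfderiv 𝓘(ℝ, F) 𝓘(ℝ, E) g x w ∈ Δ (g x)) :
    ∃ (c : ℝ → D) (ε : ℝ), 0 < ε ∧ c 0 = x ∧ ContinuousOn c (Ioo (-ε) ε) ∧
      IsTangentOn Δ (g ∘ c) (Ioo (-ε) ε) ∧
      ∃ d : TangentSpace 𝓘(ℝ, ℝ) (0 : ℝ) →L[ℝ] TangentSpace 𝓘(ℝ, F) (c 0),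
        HasMFDerivAt 𝓘(ℝ, ℝ) 𝓘(ℝ, F) c 0 d ∧ (d (1 : ℝ) : F) = w := by
  obtain ⟨k, N, ℓ, u, hframe⟩ := exists_isNormalizedFrame hΔ (g x)
  obtain ⟨Y, a, hY, hYx, hlift⟩ := hframe.exists_lift_field (hg x) hsurj hw
  let ψ := extChartAt 𝓘(ℝ, F) x
  obtain ⟨α, α_zero, r, hr, hα⟩ :=
    hY.exists_forall_mem_closedBall_exists_eq_forall_mem_Ioo_hasDerivAt₀ 0
  have zero_mem : (0 : ℝ) ∈ Ioo (0 - r) (0 + r) := by simp [hr]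
  have hnear := (eventually_chart_symm
    (hframe.eventually_mem_preimage hg.continuous.continuousAt)).and hlift
  rw [← α_zero] at hnear
  obtain ⟨ε, hε, hball⟩ := Metric.eventually_nhds_iff_ball.1
    (((hα 0 zero_mem).continuousAt.eventually hnear).and (isOpen_Ioo.mem_nhds zero_mem))
  rw [Real.ball_eq_Ioo, zero_sub, zero_add] at hball
  have hderiv : ∀ t ∈ Ioo (-ε) ε, ∃ d : TangentSpace 𝓘(ℝ, ℝ) t →L[ℝ]
      TangentSpace 𝓘(ℝ, F) (ψ.symm (α t)),
      HasMFDerivAt 𝓘(ℝ, ℝ) 𝓘(ℝ, F) (fun t ↦ ψ.symm (α t)) t d ∧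
      d (1 : ℝ) = mfderiv 𝓘(ℝ, F) 𝓘(ℝ, F) ψ.symm (α t) (Y (α t)) := fun t ht ↦
    hasMFDerivAt_chart_symm_comp (hball t ht).1.1.1 (hα t (hball t ht).2)
  obtain ⟨d, hd, d_one⟩ := hderiv 0 (by simp [hε])
  refine ⟨fun t ↦ ψ.symm (α t), ε, hε, (congrArg ψ.symm α_zero).trans (extChartAt_to_inv x),
    fun t ht ↦ ?_, fun t ht ↦ ?_, d, hd, d_one.trans ?_⟩
  · obtain ⟨d, hd, -⟩ := hderiv t ht
    exact hd.continuousAt.continuousWithinAt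
  · obtain ⟨⟨⟨hy, hs, hu⟩, hlift⟩, -⟩ := hball t ht
    obtain ⟨d, hd, d_one⟩ := hderiv t ht
    have hgd : MDifferentiableAt 𝓘(ℝ, F) 𝓘(ℝ, E) g (ψ.symm (α t)) := hg.mdifferentiableAt (by simp)
    refine ⟨_, (hgd.hasMFDerivAt.comp t hd).hasMFDerivWithinAt, ?_⟩
    have hmem := (hframe.mfderiv_mem_iff hy hs hu hgd (Y (α t))).2 (by
      rw [hlift]
      exact congrArg _ (hframe.left_inv _ hu a))
    rwa [← d_one] at hmem
  · exact (mfderiv_apply_congr _ α_zero ((congrArg Y α_zero).trans hYx)).trans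
      (mfderiv_chart_symm_mfderiv_chart (mem_extChartAt_source x) w)

theorem mfderiv_mem_of_reachable [FiniteDimensional ℝ E] [CompleteSpace F]
    [SecondCountableTopology M] (hΔ : IsDistribution Δ) (hI : IsInvolutive Δ) {h : D → M}
    (hg : ContMDiff 𝓘(ℝ, F) 𝓘(ℝ, E) ∞ g) (hh : ContMDiff 𝓘(ℝ, F) 𝓘(ℝ, E) ∞ h)
    (hgh : ∀ y, Reachable Δ (g y) (h y))
    (hsurj : Function.Surjective (mfderiv 𝓘(ℝ, F) 𝓘(ℝ, E) g x)) {w : TangentSpace 𝓘(ℝ, F) x}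
    (hw : mfderiv 𝓘(ℝ, F) 𝓘(ℝ, E) g x w ∈ Δ (g x)) :
    mfderiv 𝓘(ℝ, F) 𝓘(ℝ, E) h x w ∈ Δ (h x) := by
  obtain ⟨c, ε, hε, rfl, hc, htangent, d, hd, rfl⟩ := exists_lift_curve hΔ hg hsurj hw
  exact tangent_of_forall_reachable hΔ hI (b := h ∘ c) hε htangent
    (hh.continuous.comp_continuousOn hc)
    ((hh.mdifferentiableAt (by simp)).hasMFDerivAt.comp 0 hd) fun t _ ↦ hgh (c t)

end Lifts

section LinearAlgebra

open Module

variable {K E₁ E₂ E₃ : Type*} [Field K] [AddCommGroup E₁] [Module K E₁] [AddCommGroup E₂]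
  [Module K E₂] [AddCommGroup E₃] [Module K E₃] [FiniteDimensional K E₃]

theorem finrank_comap_inf_comap_le {A B : E₂ →ₗ[K] E₃} (hAB : A.ker ⊓ B.ker = ⊥)
    (W₁ W₂ : Submodule K E₃) :
    finrank K ↥(W₁.comap A ⊓ W₂.comap B) ≤ finrank K W₁ + finrank K W₂ := by
  let f : ↥(W₁.comap A ⊓ W₂.comap B) →ₗ[K] W₁ × W₂ := LinearMap.prod
    ((A ∘ₗ Submodule.subtype _).codRestrict W₁ fun p ↦ p.2.1)
    ((B ∘ₗ Submodule.subtype _).codRestrict W₂ fun p ↦ p.2.2)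
  have hf : Function.Injective f := (injective_iff_map_eq_zero f).2 fun p hp ↦ by
    have hA : A p = 0 := congrArg (fun z : W₁ × W₂ ↦ (z.1 : E₃)) hp
    have hB : B p = 0 := congrArg (fun z : W₁ × W₂ ↦ (z.2 : E₃)) hp
    exact Subtype.ext ((Submodule.eq_bot_iff _).1 hAB p ⟨hA, hB⟩)
  rw [← finrank_prod]
  exact LinearMap.finrank_le_finrank_of_injective hf

theorem finrank_add_finrank_le_finrank_comap_add [FiniteDimensional K E₁] (f : E₁ →ₗ[K] E₃)
    (W : Submodule K E₃) :
    finrank K E₁ + finrank K W ≤ finrank K (W.comap f) + finrank K E₃ := by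
  have hquot : finrank K (E₁ ⧸ W.comap f) ≤ finrank K (E₃ ⧸ W) := by
    refine LinearMap.finrank_le_finrank_of_injective (f := (W.comap f).mapQ W f le_rfl) ?_
    rw [← LinearMap.ker_eq_bot, Submodule.ker_mapQ, Submodule.mkQ_map_self]
  have := Submodule.finrank_quotient_add_finrank (W.comap f)
  have := Submodule.finrank_quotient_add_finrank W
  omega

theorem comap_inf_comap_le_range [FiniteDimensional K E₁] [FiniteDimensional K E₂]
    {A B : E₂ →ₗ[K] E₃} {i : E₁ →ₗ[K] E₂} {W₁ W₂ : Submodule K E₃} (hi : Function.Injective i)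
    (hAB : A.ker ⊓ B.ker = ⊥) (hdim : finrank K E₁ = finrank K E₃ + finrank K W₂)
    (h : ∀ w, A (i w) ∈ W₁ → B (i w) ∈ W₂) :
    W₁.comap A ⊓ W₂.comap B ≤ i.range := by
  have hle : (W₁.comap (A ∘ₗ i)).map i ≤ W₁.comap A ⊓ W₂.comap B := by
    rintro _ ⟨w, hw, rfl⟩
    exact ⟨hw, h w hw⟩
  have hupper := finrank_comap_inf_comap_le hAB W₁ W₂
  have hlower := finrank_add_finrank_le_finrank_comap_add (A ∘ₗ i) W₁
  have hmap := ((W₁.comap (A ∘ₗ i)).equivMapOfInjective i hi).finrank_eq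
  rw [← Submodule.eq_of_le_of_finrank_le hle (by omega)]
  exact LinearMap.map_le_range

end LinearAlgebra

/-! ### One forms -/

section Calculus

open VectorField

variable {F G H : Type*} [NormedAddCommGroup F] [NormedSpace ℝ F]
  [NormedAddCommGroup G] [NormedSpace ℝ G] [NormedAddCommGroup H] [NormedSpace ℝ H]

theorem fderiv_apply_add_apply_fderiv {A : F → G →L[ℝ] H} {Z : F → G} {g : F → H} {y : F}
    (hA : DifferentiableAt ℝ A y) (hZ : DifferentiableAt ℝ Z y)
    (h : ∀ᶠ z in 𝓝 y, A z (Z z) = g z) (w : F) :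
    fderiv ℝ A y w (Z y) + A y (fderiv ℝ Z y w) = fderiv ℝ g y w := by
  have hAZ : HasFDerivAt g _ y := (hA.hasFDerivAt.clm_apply hZ.hasFDerivAt).congr_of_eventuallyEq
    (h.mono fun _ hz ↦ hz.symm)
  rw [hAZ.fderiv]
  simp [add_comm]

theorem fderiv_lieBracket_of_related {f : F → G} {Y Z : F → F} {Y' Z' : G → G} {y : F}
    (hf : ContDiffAt ℝ 2 f y) (hY : DifferentiableAt ℝ Y y) (hZ : DifferentiableAt ℝ Z y)
    (hY' : DifferentiableAt ℝ Y' (f y)) (hZ' : DifferentiableAt ℝ Z' (f y))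
    (hYY' : ∀ᶠ z in 𝓝 y, fderiv ℝ f z (Y z) = Y' (f z))
    (hZZ' : ∀ᶠ z in 𝓝 y, fderiv ℝ f z (Z z) = Z' (f z)) :
    fderiv ℝ f y (lieBracket ℝ Y Z y) = lieBracket ℝ Y' Z' (f y) := by
  have hf₁ : DifferentiableAt ℝ f y := hf.differentiableAt (by simp)
  have hf₂ : DifferentiableAt ℝ (fderiv ℝ f) y :=
    (hf.fderiv_right (m := 1) (by norm_num)).differentiableAt (by simp)
  have hderivY := fderiv_apply_add_apply_fderiv hf₂ hY hYY' (Z y)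
  have hderivZ := fderiv_apply_add_apply_fderiv hf₂ hZ hZZ' (Y y)
  have hchain {X : G → G} (hX : DifferentiableAt ℝ X (f y)) (v : F) :
      fderiv ℝ (fun z ↦ X (f z)) y v = fderiv ℝ X (f y) (fderiv ℝ f y v) :=
    DFunLike.congr_fun (fderiv_comp y hX hf₁) v
  rw [hchain hY', hZZ'.self_of_nhds, (hf.isSymmSndFDerivAt (by simp)) (Z y) (Y y)] at hderivY
  rw [hchain hZ', hYY'.self_of_nhds] at hderivZ
  rw [lieBracket, lieBracket, map_sub, ← hderivY, ← hderivZ, add_sub_add_left_eq_sub]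

theorem fderiv_sub_fderiv_eq_neg_apply_lieBracket {β : F → F →L[ℝ] H} {Y Z : F → F} {y : F}
    (hβ : DifferentiableAt ℝ β y) (hY : DifferentiableAt ℝ Y y) (hZ : DifferentiableAt ℝ Z y)
    (hβY : ∀ᶠ z in 𝓝 y, β z (Y z) = 0) (hβZ : ∀ᶠ z in 𝓝 y, β z (Z z) = 0) :
    fderiv ℝ β y (Y y) (Z y) - fderiv ℝ β y (Z y) (Y y) = -β y (lieBracket ℝ Y Z y) := by
  have hderivY := fderiv_apply_add_apply_fderiv hβ hY hβY (Z y)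
  have hderivZ := fderiv_apply_add_apply_fderiv hβ hZ hβZ (Y y)
  rw [fderiv_fun_const, Pi.zero_apply, zero_apply] at hderivY hderivZ
  rw [lieBracket, map_sub, eq_neg_of_add_eq_zero_left hderivY,
    eq_neg_of_add_eq_zero_left hderivZ]
  abel

/-- The pull-back `f^*θ` of a one form `θ` on a normed space: the local representative of the
pull-back of a one form on a manifold, see `oneFormInChart_pullbackOneForm`. -/
def pullbackForm (f : F → G) (θ : G → G →L[ℝ] H) (y : F) : F →L[ℝ] H :=
  (θ (f y)).comp (fderiv ℝ f y)

variable {f : F → G} {θ : G → G →L[ℝ] H} {y : F} (hf : ContDiffAt ℝ 2 f y)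
  (hθ : DifferentiableAt ℝ θ (f y))
include hf hθ

theorem differentiableAt_pullbackForm : DifferentiableAt ℝ (pullbackForm f θ) y :=
  (hθ.comp y (hf.differentiableAt (by simp))).clm_comp
    ((hf.fderiv_right (m := 1) (by norm_num)).differentiableAt (by simp))

theorem fderiv_pullbackForm_apply (a b : F) :
    fderiv ℝ (pullbackForm f θ) y a b =
      θ (f y) (fderiv ℝ (fderiv ℝ f) y a b) +
        fderiv ℝ θ (f y) (fderiv ℝ f y a) (fderiv ℝ f y b) := by
  have hf₂ : DifferentiableAt ℝ (fderiv ℝ f) y :=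
    (hf.fderiv_right (m := 1) (by norm_num)).differentiableAt (by simp)
  have hderiv : HasFDerivAt (pullbackForm f θ) _ y :=
    (hθ.hasFDerivAt.comp y (hf.differentiableAt (by simp)).hasFDerivAt).clm_comp hf₂.hasFDerivAt
  rw [hderiv.fderiv]
  simp

theorem fderiv_pullbackForm_sub (a b : F) :
    fderiv ℝ (pullbackForm f θ) y a b - fderiv ℝ (pullbackForm f θ) y b a =
      fderiv ℝ θ (f y) (fderiv ℝ f y a) (fderiv ℝ f y b) -
        fderiv ℝ θ (f y) (fderiv ℝ f y b) (fderiv ℝ f y a) := by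
  rw [fderiv_pullbackForm_apply hf hθ, fderiv_pullbackForm_apply hf hθ,
    (hf.isSymmSndFDerivAt (by simp)) a b, add_sub_add_left_eq_sub]

end Calculus

section OneForms

variable {E : Type*} [NormedAddCommGroup E] [NormedSpace ℝ E]
  {M : Type*} [TopologicalSpace M] [ChartedSpace E M]

theorem oneForm_congr (θ : ∀ m : M, TangentSpace 𝓘(ℝ, E) m →L[ℝ] ℝ) {m m' : M} (h : m = m')
    {v v' : E} (hv : v = v') : (θ m : E →L[ℝ] ℝ) v = (θ m' : E →L[ℝ] ℝ) v' := by
  subst h hv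
  rfl

/-- The one form `θ` on `M` is differentiable at `m`, in terms of its local representative in the
preferred chart at `m`: this is what the definition of `dOneForm θ m` presupposes. -/
def IsDifferentiableOneFormAt (θ : ∀ m : M, TangentSpace 𝓘(ℝ, E) m →L[ℝ] ℝ) (m : M) : Prop :=
  DifferentiableAt ℝ (oneFormInChart θ m) (extChartAt 𝓘(ℝ, E) m m)

theorem oneFormInChart_sub (θ η : ∀ m : M, TangentSpace 𝓘(ℝ, E) m →L[ℝ] ℝ) (m : M) :
    oneFormInChart (θ - η) m = oneFormInChart θ m - oneFormInChart η m :=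
  funext fun _ ↦ ContinuousLinearMap.sub_comp ..

theorem IsDifferentiableOneFormAt.sub {θ η : ∀ m : M, TangentSpace 𝓘(ℝ, E) m →L[ℝ] ℝ} {m : M}
    (hθ : IsDifferentiableOneFormAt θ m) (hη : IsDifferentiableOneFormAt η m) :
    IsDifferentiableOneFormAt (θ - η) m := by
  rw [IsDifferentiableOneFormAt, oneFormInChart_sub]
  exact DifferentiableAt.sub hθ hη

theorem dOneForm_sub {θ η : ∀ m : M, TangentSpace 𝓘(ℝ, E) m →L[ℝ] ℝ} {m : M}
    (hθ : IsDifferentiableOneFormAt θ m) (hη : IsDifferentiableOneFormAt η m)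
    (a b : TangentSpace 𝓘(ℝ, E) m) :
    dOneForm (θ - η) m a b = dOneForm θ m a b - dOneForm η m a b := by
  unfold dOneForm
  rw [oneFormInChart_sub, fderiv_sub hθ hη]
  exact sub_sub_sub_comm _ _ _ _

variable [IsManifold 𝓘(ℝ, E) ∞ M]

theorem IsSmoothOneForm.contDiffAt_oneFormInChart
    {θ : ∀ m : M, TangentSpace 𝓘(ℝ, E) m →L[ℝ] ℝ} (hθ : IsSmoothOneForm θ) (m : M) :
    ContDiffAt ℝ ∞ (oneFormInChart θ m) (extChartAt 𝓘(ℝ, E) m m) := by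
  have hbundle := ((contMDiffAt_hom_bundle (E₂ := Bundle.Trivial M ℝ) _).1 (hθ m)).2
  refine (contMDiffAt_iff_contDiffAt.1 (hbundle.comp_of_eq (contMDiffAt_chart_symm
    (mem_extChartAt_target m)) (extChartAt_to_inv m))).congr_of_eventuallyEq ?_
  filter_upwards [extChartAt_target_mem_nhds (I := 𝓘(ℝ, E)) m] with y hy
  have hys : (extChartAt 𝓘(ℝ, E) m).symm y ∈ (chartAt E m).source := by
    rw [← extChartAt_source 𝓘(ℝ, E)]
    exact (extChartAt 𝓘(ℝ, E) m).map_target hy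
  have hsymm := TangentBundle.symmL_trivializationAt (I := 𝓘(ℝ, E)) hys
  rw [(extChartAt 𝓘(ℝ, E) m).right_inv hy, show Set.range 𝓘(ℝ, E) = Set.univ by simp,
    mfderivWithin_univ] at hsymm
  have htrivial : (trivializationAt ℝ (Bundle.Trivial M ℝ) m).continuousLinearMapAt ℝ
      ((extChartAt 𝓘(ℝ, E) m).symm y) = ContinuousLinearMap.id ℝ ℝ :=
    Bundle.Trivial.continuousLinearMapAt_trivialization ..
  ext k
  refine (congrArg (θ ((extChartAt 𝓘(ℝ, E) m).symm y)) (DFunLike.congr_fun hsymm k)).symm.trans ?_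
  exact (DFunLike.congr_fun htrivial _).symm

theorem IsSmoothOneForm.isDifferentiableOneFormAt {θ : ∀ m : M, TangentSpace 𝓘(ℝ, E) m →L[ℝ] ℝ}
    (hθ : IsSmoothOneForm θ) (m : M) : IsDifferentiableOneFormAt θ m :=
  (hθ.contDiffAt_oneFormInChart m).differentiableAt (by simp)

end OneForms

section PullBack

variable {E : Type*} [NormedAddCommGroup E] [NormedSpace ℝ E]
  {M : Type*} [TopologicalSpace M] [ChartedSpace E M]
  {F : Type*} [NormedAddCommGroup F] [NormedSpace ℝ F]
  {D : Type*} [TopologicalSpace D] [ChartedSpace F D]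

/-- The pull-back `g^*θ` of the one form `θ` on `M` by the map `g`. -/
def pullbackOneForm (g : D → M) (θ : ∀ m : M, TangentSpace 𝓘(ℝ, E) m →L[ℝ] ℝ) (x : D) :
    TangentSpace 𝓘(ℝ, F) x →L[ℝ] ℝ :=
  (θ (g x)).comp (mfderiv 𝓘(ℝ, F) 𝓘(ℝ, E) g x)

variable [IsManifold 𝓘(ℝ, E) ∞ M] [IsManifold 𝓘(ℝ, F) ∞ D] {g : D → M} {x : D}
  {θ : ∀ m : M, TangentSpace 𝓘(ℝ, E) m →L[ℝ] ℝ}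

theorem oneFormInChart_pullbackOneForm (hg : ∀ᶠ z in 𝓝 x, MDifferentiableAt 𝓘(ℝ, F) 𝓘(ℝ, E) g z)
    (θ : ∀ m : M, TangentSpace 𝓘(ℝ, E) m →L[ℝ] ℝ) :
    oneFormInChart (pullbackOneForm g θ) x =ᶠ[𝓝 (extChartAt 𝓘(ℝ, F) x x)]
      pullbackForm (writtenInExtChartAt 𝓘(ℝ, F) 𝓘(ℝ, E) x g) (oneFormInChart θ (g x)) := by
  filter_upwards [eventually_chart_symm (hg.and (hg.self_of_nhds.continuousAt.eventually
    (extChartAt_source_mem_nhds (I := 𝓘(ℝ, E)) (g x))))] with y ⟨hy, hgy, hs⟩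
  ext k
  refine (oneForm_congr θ ((extChartAt 𝓘(ℝ, E) (g x)).left_inv hs) ?_).symm
  exact (congrArg (mfderiv 𝓘(ℝ, E) 𝓘(ℝ, E) (extChartAt 𝓘(ℝ, E) (g x)).symm
    (extChartAt 𝓘(ℝ, E) (g x) (g ((extChartAt 𝓘(ℝ, F) x).symm y))))
    (fderiv_writtenInExtChartAt hy hs hgy k)).trans (mfderiv_chart_symm_mfderiv_chart hs _)

theorem eventually_mdifferentiableAt (hg : ContMDiffAt 𝓘(ℝ, F) 𝓘(ℝ, E) ∞ g x) :
    ∀ᶠ z in 𝓝 x, MDifferentiableAt 𝓘(ℝ, F) 𝓘(ℝ, E) g z :=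
  ((contMDiffAt_iff_contMDiffAt_nhds (by simp)).1 (hg.of_le (m := 1) ENat.LEInfty.out)).mono
    fun _ hz ↦ hz.mdifferentiableAt (by simp)

variable (hg : ContMDiffAt 𝓘(ℝ, F) 𝓘(ℝ, E) ∞ g x) (hθ : IsDifferentiableOneFormAt θ (g x))
include hg hθ

theorem isDifferentiableOneFormAt_pullbackOneForm :
    IsDifferentiableOneFormAt (E := F) (pullbackOneForm g θ) x := by
  refine (differentiableAt_pullbackForm
    ((contDiffAt_writtenInExtChartAt_self hg).of_le ENat.LEInfty.out) ?_).congr_of_eventuallyEq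
    (oneFormInChart_pullbackOneForm (eventually_mdifferentiableAt hg) θ)
  rwa [writtenInExtChartAt_self]

theorem dOneForm_pullbackOneForm (a b : TangentSpace 𝓘(ℝ, F) x) :
    dOneForm (pullbackOneForm g θ) x a b =
      dOneForm θ (g x) (mfderiv 𝓘(ℝ, F) 𝓘(ℝ, E) g x a) (mfderiv 𝓘(ℝ, F) 𝓘(ℝ, E) g x b) := by
  have hgd : ∀ᶠ z in 𝓝 x, MDifferentiableAt 𝓘(ℝ, F) 𝓘(ℝ, E) g z :=
    eventually_mdifferentiableAt hg
  unfold dOneForm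
  rw [(oneFormInChart_pullbackOneForm hgd θ).fderiv_eq]
  refine (fderiv_pullbackForm_sub
    ((contDiffAt_writtenInExtChartAt_self hg).of_le ENat.LEInfty.out) ?_ _ _).trans ?_
  · rwa [writtenInExtChartAt_self]
  · rw [writtenInExtChartAt_self]
    exact congrArg₂ (fun p q : E ↦ fderiv ℝ (oneFormInChart θ (g x))
      (extChartAt 𝓘(ℝ, E) (g x) (g x)) p q - fderiv ℝ (oneFormInChart θ (g x))
      (extChartAt 𝓘(ℝ, E) (g x) (g x)) q p)
      (fderiv_writtenInExtChartAt_self hgd.self_of_nhds a)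
      (fderiv_writtenInExtChartAt_self hgd.self_of_nhds b)

end PullBack

section Vanishing

open VectorField

variable {E : Type*} [NormedAddCommGroup E] [NormedSpace ℝ E]
  {M : Type*} [TopologicalSpace M] [ChartedSpace E M] [IsManifold 𝓘(ℝ, E) ∞ M]
  {Δ : ∀ m : M, Submodule ℝ (TangentSpace 𝓘(ℝ, E) m)}

theorem IsNormalizedFrame.lieBracket_eq_zero [CompleteSpace E] {E₁ : Type*}
    [NormedAddCommGroup E₁] [NormedSpace ℝ E₁] {m₀ : M} {N : E → E₁ →L[ℝ] E} {ℓ : E →L[ℝ] E₁}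
    {u : Set E} (h : IsNormalizedFrame Δ m₀ N ℓ u) (hI : IsInvolutive Δ) {y : E} (hy : y ∈ u)
    (a b : E₁) : lieBracket ℝ (fun z ↦ N z a) (fun z ↦ N z b) y = 0 := by
  have hderiv (c : E₁) (v : E) : fderiv ℝ (fun z ↦ N z c) y v = fderiv ℝ N y v c := by
    simp [fderiv_clm_apply (h.differentiableAt hy) (differentiableAt_const c)]
  rw [lieBracket, hderiv, hderiv, h.comm hI hy, sub_self]

variable {F : Type*} [NormedAddCommGroup F] [NormedSpace ℝ F]
  {D : Type*} [TopologicalSpace D] [ChartedSpace F D] [IsManifold 𝓘(ℝ, F) ∞ D]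

/-- Two vectors of `(Tf)⁻¹(Δ)` extend to fields `Y`, `Z` that lift commuting fields of a frame of
`Δ`. Then `Tf([Y, Z]) = 0`, and `dβ(Y, Z) = Y(β(Z)) - Z(β(Y)) - β([Y, Z])` vanishes term by term. -/
theorem dOneForm_eq_zero_of_eventually_eq_zero [FiniteDimensional ℝ E] (hΔ : IsDistribution Δ)
    (hI : IsInvolutive Δ) {f : D → M} {x : D} (hf : ContMDiff 𝓘(ℝ, F) 𝓘(ℝ, E) ∞ f)
    (hsurj : Function.Surjective (mfderiv 𝓘(ℝ, F) 𝓘(ℝ, E) f x))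
    {β : ∀ z : D, TangentSpace 𝓘(ℝ, F) z →L[ℝ] ℝ} (hβ : IsDifferentiableOneFormAt β x)
    (hvanish : ∀ᶠ z in 𝓝 x, ∀ w, mfderiv 𝓘(ℝ, F) 𝓘(ℝ, E) f z w ∈ Δ (f z) → β z w = 0)
    {a b : TangentSpace 𝓘(ℝ, F) x} (ha : mfderiv 𝓘(ℝ, F) 𝓘(ℝ, E) f x a ∈ Δ (f x))
    (hb : mfderiv 𝓘(ℝ, F) 𝓘(ℝ, E) f x b ∈ Δ (f x)) :
    dOneForm β x a b = 0 := by
  have : CompleteSpace E := FiniteDimensional.complete ℝ E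
  obtain ⟨k, N, ℓ, u, hframe⟩ := exists_isNormalizedFrame hΔ (f x)
  obtain ⟨Y, a', hY, hYx, hYlift⟩ := hframe.exists_lift_field (hf x) hsurj ha
  obtain ⟨Z, b', hZ, hZx, hZlift⟩ := hframe.exists_lift_field (hf x) hsurj hb
  let f' := writtenInExtChartAt 𝓘(ℝ, F) 𝓘(ℝ, E) x f
  let y₀ := extChartAt 𝓘(ℝ, F) x x
  have hf' : ContDiffAt ℝ 2 f' y₀ :=
    (contDiffAt_writtenInExtChartAt_self (hf x)).of_le ENat.LEInfty.out
  have hY₁ : DifferentiableAt ℝ Y y₀ := hY.differentiableAt (by simp)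
  have hZ₁ : DifferentiableAt ℝ Z y₀ := hZ.differentiableAt (by simp)
  have hvanish_chart : ∀ᶠ y in 𝓝 y₀, ∀ c k, fderiv ℝ f' y k = N (f' y) c →
      oneFormInChart β x y k = 0 := by
    filter_upwards [eventually_chart_symm (hvanish.and
      (hframe.eventually_mem_preimage hf.continuous.continuousAt))]
      with y ⟨hy, hβy, hs, hu⟩ c k hk
    refine hβy _ ((hframe.mfderiv_mem_iff hy hs hu (hf.mdifferentiableAt (by simp)) k).2 ?_)
    exact (congrArg (fun e ↦ N (f' y) (ℓ e)) hk).trans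
      ((congrArg (N (f' y)) (hframe.left_inv _ hu c)).trans hk.symm)
  have hmem : f' y₀ ∈ u := Set.mem_of_eq_of_mem (writtenInExtChartAt_self f x) hframe.mem
  have hN : DifferentiableAt ℝ N (f' y₀) := hframe.differentiableAt hmem
  have hbracket : fderiv ℝ f' y₀ (lieBracket ℝ Y Z y₀) = 0 :=
    (fderiv_lieBracket_of_related hf' hY₁ hZ₁ (hN.clm_apply (differentiableAt_const a'))
      (hN.clm_apply (differentiableAt_const b')) hYlift hZlift).trans
      (hframe.lieBracket_eq_zero hI hmem a' b')
  have hdβ := fderiv_sub_fderiv_eq_neg_apply_lieBracket hβ hY₁ hZ₁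
    (hYlift.mp (hvanish_chart.mono fun y hy ↦ hy a' _))
    (hZlift.mp (hvanish_chart.mono fun y hy ↦ hy b' _))
  rw [hvanish_chart.self_of_nhds 0 _ (hbracket.trans (map_zero _).symm), neg_zero, hYx, hZx] at hdβ
  exact hdβ

end Vanishing

theorem contDiffAt_of_eventually_exists {P F G H K : Type*} [NormedAddCommGroup P]
    [NormedSpace ℝ P] [NormedAddCommGroup F] [NormedSpace ℝ F] [CompleteSpace F]
    [NormedAddCommGroup G] [NormedSpace ℝ G] [NormedAddCommGroup H] [NormedSpace ℝ H]
    [NormedAddCommGroup K] [NormedSpace ℝ K] {n : WithTop ℕ∞} {A : P → F →L[ℝ] G}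
    {B : P → H →L[ℝ] G} {σ : P → F →L[ℝ] K} {τ : P → H →L[ℝ] K} {p₀ : P}
    (hA : ContDiffAt ℝ n A p₀) (hB : ContDiffAt ℝ n B p₀) (hσ : ContDiffAt ℝ n σ p₀)
    (hinv : (A p₀).IsInvertible)
    (h : ∀ᶠ p in 𝓝 p₀, ∀ k, ∃ j, A p j = B p k ∧ τ p k = σ p j) : ContDiffAt ℝ n τ p₀ := by
  obtain ⟨e, he⟩ := hinv
  have hinverse : ContDiffAt ℝ n (fun p ↦ (A p).inverse) p₀ :=
    (he ▸ contDiffAt_map_inverse e).comp p₀ hA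
  have hinvertible : ∀ᶠ p in 𝓝 p₀, (A p).IsInvertible := hA.continuousAt.eventually (he ▸ e.nhds)
  refine (hσ.clm_comp (hinverse.clm_comp hB)).congr_of_eventuallyEq ?_
  filter_upwards [h, hinvertible] with p hp hAp
  ext k
  obtain ⟨j, hj, hτ⟩ := hp k
  exact hτ.trans (congrArg (σ p) (hAp.inverse_apply_eq.2 hj.symm).symm)

/-! ### Discrete constrained Lagrangian systems -/

section Parts

variable {EQ : Type*} [NormedAddCommGroup EQ] [NormedSpace ℝ EQ]
  {Q : Type*} [TopologicalSpace Q] [ChartedSpace EQ Q]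
  {EV : Type*} [NormedAddCommGroup EV] [NormedSpace ℝ EV]
  {V : Type*} [TopologicalSpace V] [ChartedSpace EV V]

namespace DiscreteTangentBundle

theorem eq_of_tPlus_eq_of_tMinus_eq (B : DiscreteTangentBundle EQ Q EV V) {v : V}
    {a b : TangentSpace 𝓘(ℝ, EV) v} (hplus : B.tPlus v a = B.tPlus v b)
    (hminus : B.tMinus v a = B.tMinus v b) : a = b := by
  have h : a - b ∈ (B.tPlus v).ker ⊓ (B.tMinus v).ker :=
    ⟨LinearMap.sub_mem_ker_iff.2 hplus, LinearMap.sub_mem_ker_iff.2 hminus⟩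
  rw [B.ker_inf_ker v] at h
  exact sub_eq_zero.1 h

/-- The map `(∂⁻, ∂⁺)`, written in the preferred charts at `v`, `∂⁻(v)` and `∂⁺(v)`. Its derivative
is invertible at `v`, which is how smoothness of `θ⁺` is obtained. -/
def bdInCharts (B : DiscreteTangentBundle EQ Q EV V) (v : V) (y : EV) : EQ × EQ :=
  (writtenInExtChartAt 𝓘(ℝ, EV) 𝓘(ℝ, EQ) v B.bdMinus y,
    writtenInExtChartAt 𝓘(ℝ, EV) 𝓘(ℝ, EQ) v B.bdPlus y)

variable [IsManifold 𝓘(ℝ, EQ) ∞ Q] [IsManifold 𝓘(ℝ, EV) ∞ V]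
  (B : DiscreteTangentBundle EQ Q EV V) (v : V)

theorem contDiffAt_bdInCharts : ContDiffAt ℝ ∞ (B.bdInCharts v) (extChartAt 𝓘(ℝ, EV) v v) :=
  (contDiffAt_writtenInExtChartAt_self (B.contMDiff_bdMinus v)).prodMk
    (contDiffAt_writtenInExtChartAt_self (B.contMDiff_bdPlus v))

theorem eventually_fderiv_bdInCharts_eq_iff :
    ∀ᶠ y in 𝓝 (extChartAt 𝓘(ℝ, EV) v v), y ∈ (extChartAt 𝓘(ℝ, EV) v).target ∧
      ∀ i j k : EV, fderiv ℝ (B.bdInCharts v) y i =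
        (fderiv ℝ (writtenInExtChartAt 𝓘(ℝ, EV) 𝓘(ℝ, EQ) v B.bdMinus) y j,
          fderiv ℝ (writtenInExtChartAt 𝓘(ℝ, EV) 𝓘(ℝ, EQ) v B.bdPlus) y k) ↔
        B.tMinus _ (mfderiv 𝓘(ℝ, EV) 𝓘(ℝ, EV) (extChartAt 𝓘(ℝ, EV) v).symm y i) =
          B.tMinus _ (mfderiv 𝓘(ℝ, EV) 𝓘(ℝ, EV) (extChartAt 𝓘(ℝ, EV) v).symm y j) ∧
        B.tPlus _ (mfderiv 𝓘(ℝ, EV) 𝓘(ℝ, EV) (extChartAt 𝓘(ℝ, EV) v).symm y i) =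
          B.tPlus _ (mfderiv 𝓘(ℝ, EV) 𝓘(ℝ, EV) (extChartAt 𝓘(ℝ, EV) v).symm y k) := by
  filter_upwards [eventually_chart_symm (.and
    (B.contMDiff_bdMinus.continuous.continuousAt.eventually
      (extChartAt_source_mem_nhds (I := 𝓘(ℝ, EQ)) (B.bdMinus v)))
    (B.contMDiff_bdPlus.continuous.continuousAt.eventually
      (extChartAt_source_mem_nhds (I := 𝓘(ℝ, EQ)) (B.bdPlus v))))]
    with y ⟨hy, hminus, hplus⟩
  refine ⟨hy, fun i j k ↦ ?_⟩
  have hdminus := contDiffAt_writtenInExtChartAt hy hminus B.contMDiff_bdMinus.contMDiffAt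
  have hdplus := contDiffAt_writtenInExtChartAt hy hplus B.contMDiff_bdPlus.contMDiffAt
  have hprod := (hdminus.differentiableAt (by simp)).fderiv_prodMk
    (hdplus.differentiableAt (by simp))
  rw [mfderiv_eq_iff_fderiv_writtenInExtChartAt_eq hy hminus
      (B.contMDiff_bdMinus.mdifferentiableAt (by simp)),
    mfderiv_eq_iff_fderiv_writtenInExtChartAt_eq hy hplus
      (B.contMDiff_bdPlus.mdifferentiableAt (by simp))]
  exact (Eq.congr_left (DFunLike.congr_fun hprod i)).trans Prod.ext_iff

variable [FiniteDimensional ℝ EQ] [FiniteDimensional ℝ EV]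

theorem isInvertible_fderiv_bdInCharts :
    (fderiv ℝ (B.bdInCharts v) (extChartAt 𝓘(ℝ, EV) v v)).IsInvertible := by
  obtain ⟨hy, heq⟩ := (B.eventually_fderiv_bdInCharts_eq_iff v).self_of_nhds
  let A := fderiv ℝ (B.bdInCharts v) (extChartAt 𝓘(ℝ, EV) v v)
  have hinj : Function.Injective A := by
    intro j k hjk
    obtain ⟨hminus, hplus⟩ := (heq j k k).1 (hjk.trans ((heq k k k).2 ⟨rfl, rfl⟩))
    exact (isInvertible_mfderiv_chart_symm hy).injective
      (B.eq_of_tPlus_eq_of_tMinus_eq hplus hminus)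
  exact ⟨(LinearEquiv.ofInjectiveOfFinrankEq A.toLinearMap hinj (by
    rw [Module.finrank_prod, B.finrank_eq, two_mul])).toContinuousLinearEquiv, rfl⟩

theorem tMinus_plusPart (a : TangentSpace 𝓘(ℝ, EV) v) : B.tMinus v (B.plusPart v a) = 0 :=
  Submodule.projection_apply_mem (B.isCompl_ker v) a

theorem tPlus_minusPart (a : TangentSpace 𝓘(ℝ, EV) v) : B.tPlus v (B.minusPart v a) = 0 :=
  Submodule.projection_apply_mem (B.isCompl_ker v).symm a

theorem plusPart_add_minusPart (a : TangentSpace 𝓘(ℝ, EV) v) :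
    B.plusPart v a + B.minusPart v a = a :=
  Submodule.projection_add_projection_eq_self (B.isCompl_ker v) a

theorem tPlus_plusPart (a : TangentSpace 𝓘(ℝ, EV) v) :
    B.tPlus v (B.plusPart v a) = B.tPlus v a := by
  have h := congrArg (B.tPlus v) (B.plusPart_add_minusPart v a)
  rwa [map_add, tPlus_minusPart, add_zero] at h

theorem tMinus_minusPart (a : TangentSpace 𝓘(ℝ, EV) v) :
    B.tMinus v (B.minusPart v a) = B.tMinus v a := by
  have h := congrArg (B.tMinus v) (B.plusPart_add_minusPart v a)
  rwa [map_add, tMinus_plusPart, zero_add] at h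

end DiscreteTangentBundle

end Parts

section Systems

variable {EQ : Type*} [NormedAddCommGroup EQ] [NormedSpace ℝ EQ]
  {Q : Type*} [TopologicalSpace Q] [ChartedSpace EQ Q] [IsManifold 𝓘(ℝ, EQ) ∞ Q]
  {EV : Type*} [NormedAddCommGroup EV] [NormedSpace ℝ EV]
  {V : Type*} [TopologicalSpace V] [ChartedSpace EV V] [IsManifold 𝓘(ℝ, EV) ∞ V]
  {ED : Type*} [NormedAddCommGroup ED] [NormedSpace ℝ ED]
  {D : Type*} [TopologicalSpace D] [ChartedSpace ED D]

namespace DCLS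

theorem mfderiv_bdPlus_incl (S : DCLS EQ Q EV V ED D) (x : D) (w : TangentSpace 𝓘(ℝ, ED) x) :
    mfderiv 𝓘(ℝ, ED) 𝓘(ℝ, EQ) (S.bdPlus ∘ S.incl) x w = S.tPlus (S.incl x) (S.tIncl x w) := by
  rw [mfderiv_comp x (S.contMDiff_bdPlus.mdifferentiableAt (by simp))
    (S.contMDiff_incl.mdifferentiableAt (by simp))]
  rfl

theorem mfderiv_bdMinus_incl (S : DCLS EQ Q EV V ED D) (x : D) (w : TangentSpace 𝓘(ℝ, ED) x) :
    mfderiv 𝓘(ℝ, ED) 𝓘(ℝ, EQ) (S.bdMinus ∘ S.incl) x w = S.tMinus (S.incl x) (S.tIncl x w) := by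
  rw [mfderiv_comp x (S.contMDiff_bdMinus.mdifferentiableAt (by simp))
    (S.contMDiff_incl.mdifferentiableAt (by simp))]
  rfl

variable {S : DCLS EQ Q EV V ED D} {F : D → D} {U U' : Set D}

theorem IsEvolutionMap.contMDiffAt (hF : S.IsEvolutionMap F U U') {x : D} (hx : x ∈ U) :
    ContMDiffAt 𝓘(ℝ, ED) 𝓘(ℝ, ED) ∞ F x :=
  hF.contMDiffOn.contMDiffAt (hF.isOpen_dom.mem_nhds hx)

theorem IsEvolutionMap.bdMinus_eq (hF : S.IsEvolutionMap F U U') {x : D} (hx : x ∈ U) :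
    S.bdMinus (S.incl (F x)) = S.bdPlus (S.incl x) :=
  (hF.isSolutionPair x hx).1.symm

theorem IsEvolutionMap.mfderiv_incl_comp (hF : S.IsEvolutionMap F U U') {x : D} (hx : x ∈ U)
    (w : TangentSpace 𝓘(ℝ, ED) x) :
    mfderiv 𝓘(ℝ, ED) 𝓘(ℝ, EV) (S.incl ∘ F) x w =
      S.tIncl (F x) (mfderiv 𝓘(ℝ, ED) 𝓘(ℝ, ED) F x w) := by
  rw [mfderiv_comp x (S.contMDiff_incl.mdifferentiableAt (by simp))
    ((hF.contMDiffAt hx).mdifferentiableAt (by simp))]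
  rfl

theorem IsEvolutionMap.tMinus_eq (hF : S.IsEvolutionMap F U U') {x : D} (hx : x ∈ U)
    (w : TangentSpace 𝓘(ℝ, ED) x) :
    (S.tMinus (S.incl (F x)) (S.tIncl (F x) (mfderiv 𝓘(ℝ, ED) 𝓘(ℝ, ED) F x w)) : EQ) =
      S.tPlus (S.incl x) (S.tIncl x w) := by
  have heq : (S.bdMinus ∘ S.incl) ∘ F =ᶠ[𝓝 x] S.bdPlus ∘ S.incl := by
    filter_upwards [hF.isOpen_dom.mem_nhds hx] with y hy using hF.bdMinus_eq hy
  have hderiv : (mfderiv 𝓘(ℝ, ED) 𝓘(ℝ, EQ) ((S.bdMinus ∘ S.incl) ∘ F) x : ED →L[ℝ] EQ) =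
      mfderiv 𝓘(ℝ, ED) 𝓘(ℝ, EQ) (S.bdPlus ∘ S.incl) x := heq.mfderiv_eq
  have hcomp : mfderiv 𝓘(ℝ, ED) 𝓘(ℝ, EQ) ((S.bdMinus ∘ S.incl) ∘ F) x w =
      S.tMinus (S.incl (F x)) (S.tIncl (F x) (mfderiv 𝓘(ℝ, ED) 𝓘(ℝ, ED) F x w)) := by
    rw [mfderiv_comp x ((S.contMDiff_bdMinus.comp S.contMDiff_incl).mdifferentiableAt (by simp))
      ((hF.contMDiffAt hx).mdifferentiableAt (by simp))]
    exact S.mfderiv_bdMinus_incl _ _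
  exact hcomp.symm.trans ((DFunLike.congr_fun hderiv w).trans (S.mfderiv_bdPlus_incl x w))

variable {Δ : ∀ q : Q, Submodule ℝ (TangentSpace 𝓘(ℝ, EQ) q)} [FiniteDimensional ℝ EQ]

theorem IsHolonomic.tPlus_mem [FiniteDimensional ℝ ED] [SecondCountableTopology Q]
    [IsManifold 𝓘(ℝ, ED) ∞ D] (hS : S.IsHolonomic Δ) {x : D} {w : TangentSpace 𝓘(ℝ, ED) x}
    (hw : S.tMinus (S.incl x) (S.tIncl x w) ∈ Δ (S.bdMinus (S.incl x))) :
    S.tPlus (S.incl x) (S.tIncl x w) ∈ Δ (S.bdPlus (S.incl x)) := by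
  have : CompleteSpace ED := FiniteDimensional.complete ℝ ED
  have hmem := mfderiv_mem_of_reachable hS.isDistribution hS.isInvolutive
    (S.contMDiff_bdMinus.comp S.contMDiff_incl) (S.contMDiff_bdPlus.comp S.contMDiff_incl)
    hS.reachable (S.surjective_bdMinus_incl x) (w := w) (by rwa [mfderiv_bdMinus_incl])
  rwa [mfderiv_bdPlus_incl] at hmem

theorem IsEvolutionMap.mfderiv_mem_K0 [FiniteDimensional ℝ ED] [SecondCountableTopology Q]
    [IsManifold 𝓘(ℝ, ED) ∞ D] (hF : S.IsEvolutionMap F U U') (hS : S.IsHolonomic Δ) {x : D}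
    (hx : x ∈ U) {w : TangentSpace 𝓘(ℝ, ED) x} (hw : S.tIncl x w ∈ S.K0 Δ x) :
    S.tIncl (F x) (mfderiv 𝓘(ℝ, ED) 𝓘(ℝ, ED) F x w) ∈ S.K0 Δ (F x) := by
  have mem_congr : ∀ {q q' : Q} {v v' : EQ}, q = q' → v = v' →
      v ∈ (Δ q : Submodule ℝ EQ) → v' ∈ (Δ q' : Submodule ℝ EQ) := by
    rintro q _ v _ rfl rfl hv
    exact hv
  have hminus : S.tMinus (S.incl (F x)) (S.tIncl (F x) (mfderiv 𝓘(ℝ, ED) 𝓘(ℝ, ED) F x w)) ∈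
      Δ (S.bdMinus (S.incl (F x))) :=
    mem_congr (hF.bdMinus_eq hx).symm (hF.tMinus_eq hx w).symm hw.2
  exact ⟨hminus, hS.tPlus_mem hminus⟩

variable [FiniteDimensional ℝ EV]

theorem thetaPlus_apply (S : DCLS EQ Q EV V ED D) (v : V) (a : TangentSpace 𝓘(ℝ, EV) v) :
    S.thetaPlus v a = S.sigma v (S.plusPart v a) := rfl

theorem thetaMinus_apply (S : DCLS EQ Q EV V ED D) (v : V) (a : TangentSpace 𝓘(ℝ, EV) v) :
    S.thetaMinus v a = -S.sigma v (S.minusPart v a) := rfl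

theorem thetaMinus_eq (S : DCLS EQ Q EV V ED D) : S.thetaMinus = S.thetaPlus - S.sigma := by
  ext v a
  have hsum := congrArg (S.sigma v) (S.plusPart_add_minusPart v a)
  rw [map_add] at hsum
  change S.thetaMinus v a = S.thetaPlus v a - S.sigma v a
  rw [thetaPlus_apply, thetaMinus_apply, ← hsum]
  ring

theorem isDifferentiableOneFormAt_thetaPlus (S : DCLS EQ Q EV V ED D) (v : V) :
    IsDifferentiableOneFormAt S.thetaPlus v := by
  have : CompleteSpace EV := FiniteDimensional.complete ℝ EV
  have hbdPlus := contDiffAt_writtenInExtChartAt_self (S.contMDiff_bdPlus v)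
  refine (contDiffAt_of_eventually_exists (n := ∞) (A := fderiv ℝ (S.bdInCharts v))
    (B := fun y ↦ (ContinuousLinearMap.inr ℝ EQ EQ).comp
      (fderiv ℝ (writtenInExtChartAt 𝓘(ℝ, EV) 𝓘(ℝ, EQ) v S.bdPlus) y))
    ((S.contDiffAt_bdInCharts v).fderiv_right (by simp))
    (contDiffAt_const.clm_comp (hbdPlus.fderiv_right (by simp)))
    (S.smooth_sigma.contDiffAt_oneFormInChart v)
    (S.isInvertible_fderiv_bdInCharts v) ?_).differentiableAt (by simp)
  filter_upwards [S.eventually_fderiv_bdInCharts_eq_iff v] with y ⟨hy, heq⟩ k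
  obtain ⟨j, hj⟩ := (isInvertible_mfderiv_chart_symm hy).surjective
    (S.plusPart _ (mfderiv 𝓘(ℝ, EV) 𝓘(ℝ, EV) (extChartAt 𝓘(ℝ, EV) v).symm y k))
  refine ⟨j, ?_, congrArg (S.sigma ((extChartAt 𝓘(ℝ, EV) v).symm y)) hj.symm⟩
  have hminus := (congrArg (S.tMinus _) hj).trans (S.tMinus_plusPart _ _)
  have hplus := (congrArg (S.tPlus _) hj).trans (S.tPlus_plusPart _ _)
  have hzero := (congrArg (S.tMinus _)
    (map_zero (mfderiv 𝓘(ℝ, EV) 𝓘(ℝ, EV) (extChartAt 𝓘(ℝ, EV) v).symm y))).trans (map_zero _)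
  have hpart := (heq j 0 k).2 ⟨hminus.trans hzero.symm, hplus⟩
  rwa [map_zero] at hpart

theorem isDifferentiableOneFormAt_thetaMinus (S : DCLS EQ Q EV V ED D) (v : V) :
    IsDifferentiableOneFormAt S.thetaMinus v := by
  rw [thetaMinus_eq]
  exact (S.isDifferentiableOneFormAt_thetaPlus v).sub (S.smooth_sigma.isDifferentiableOneFormAt v)

theorem omegaPlus_eq_omegaMinus (S : DCLS EQ Q EV V ED D)
    (hclosed : ∀ v δv δw, dOneForm S.sigma v δv δw = 0) (v : V)
    (δv δw : TangentSpace 𝓘(ℝ, EV) v) : S.omegaPlus v δv δw = S.omegaMinus v δv δw := by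
  rw [omegaPlus, omegaMinus, thetaMinus_eq, dOneForm_sub (S.isDifferentiableOneFormAt_thetaPlus v)
    (S.smooth_sigma.isDifferentiableOneFormAt v), hclosed, sub_zero]

/-- The Lagrange-d'Alembert principle is applied to the variations `w⁺` at `x` and `(TF w)⁻` at
`F x`. -/
theorem IsEvolutionMap.thetaPlus_eq_thetaMinus (hF : S.IsEvolutionMap F U U')
    (hS : S.HasLinearConstraints Δ) {x : D} (hx : x ∈ U) {w : TangentSpace 𝓘(ℝ, ED) x}
    (hw : S.tPlus (S.incl x) (S.tIncl x w) ∈ Δ (S.bdPlus (S.incl x))) :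
    S.thetaPlus (S.incl x) (S.tIncl x w) = S.thetaMinus (S.incl (F x))
      (S.tIncl (F x) (mfderiv 𝓘(ℝ, ED) 𝓘(ℝ, ED) F x w)) := by
  have tangentBundle_ext : ∀ {q q' : Q} {v v' : EQ}, q = q' → v = v' →
      (⟨q, v⟩ : TangentBundle 𝓘(ℝ, EQ) Q) = ⟨q', v'⟩ := by
    rintro q _ v _ rfl rfl
    rfl
  have hsolution := (hF.isSolutionPair x hx).2 (S.plusPart (S.incl x) (S.tIncl x w))
    (S.minusPart (S.incl (F x)) (S.tIncl (F x) (mfderiv 𝓘(ℝ, ED) 𝓘(ℝ, ED) F x w)))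
    (by rw [S.tPlus_plusPart, hS.variations_eq]; exact hw)
    (S.tMinus_plusPart _ _) (S.tPlus_minusPart _ _)
    (tangentBundle_ext (hF.bdMinus_eq hx).symm ((S.tPlus_plusPart _ _).trans
      ((hF.tMinus_eq hx w).symm.trans (S.tMinus_minusPart _ _).symm)))
  rw [thetaPlus_apply, thetaMinus_apply]
  exact eq_neg_of_add_eq_zero_left hsolution

variable [IsManifold 𝓘(ℝ, ED) ∞ D]

theorem IsEvolutionMap.omegaMinus_eq_omegaPlus (hF : S.IsEvolutionMap F U U')
    (hS : S.IsHolonomic Δ) {x : D} (hx : x ∈ U) {a b : TangentSpace 𝓘(ℝ, ED) x}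
    (ha : S.tPlus (S.incl x) (S.tIncl x a) ∈ Δ (S.bdPlus (S.incl x)))
    (hb : S.tPlus (S.incl x) (S.tIncl x b) ∈ Δ (S.bdPlus (S.incl x))) :
    S.omegaMinus (S.incl (F x)) (S.tIncl (F x) (mfderiv 𝓘(ℝ, ED) 𝓘(ℝ, ED) F x a))
      (S.tIncl (F x) (mfderiv 𝓘(ℝ, ED) 𝓘(ℝ, ED) F x b)) =
    S.omegaPlus (S.incl x) (S.tIncl x a) (S.tIncl x b) := by
  have hinclF : ContMDiffAt 𝓘(ℝ, ED) 𝓘(ℝ, EV) ∞ (S.incl ∘ F) x :=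
    S.contMDiff_incl.contMDiffAt.comp x (hF.contMDiffAt hx)
  have hθplus : IsDifferentiableOneFormAt (E := ED) (pullbackOneForm S.incl S.thetaPlus) x :=
    isDifferentiableOneFormAt_pullbackOneForm S.contMDiff_incl.contMDiffAt
      (S.isDifferentiableOneFormAt_thetaPlus _)
  have hθminus : IsDifferentiableOneFormAt (E := ED)
      (pullbackOneForm (S.incl ∘ F) S.thetaMinus) x :=
    isDifferentiableOneFormAt_pullbackOneForm hinclF (S.isDifferentiableOneFormAt_thetaMinus _)
  have hvanish : ∀ᶠ z in 𝓝 x, ∀ w : TangentSpace 𝓘(ℝ, ED) z,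
      mfderiv 𝓘(ℝ, ED) 𝓘(ℝ, EQ) (S.bdPlus ∘ S.incl) z w ∈ Δ ((S.bdPlus ∘ S.incl) z) →
      (pullbackOneForm S.incl S.thetaPlus - pullbackOneForm (S.incl ∘ F) S.thetaMinus :
        ∀ z : D, TangentSpace 𝓘(ℝ, ED) z →L[ℝ] ℝ) z w = 0 := by
    filter_upwards [hF.isOpen_dom.mem_nhds hx] with z hz w hw
    rw [mfderiv_bdPlus_incl] at hw
    exact sub_eq_zero.2 ((hF.thetaPlus_eq_thetaMinus hS.toHasLinearConstraints hz hw).trans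
      (congrArg (S.thetaMinus (S.incl (F z))) (hF.mfderiv_incl_comp hz w)).symm)
  have hd := dOneForm_eq_zero_of_eventually_eq_zero hS.isDistribution hS.isInvolutive
    (S.contMDiff_bdPlus.comp S.contMDiff_incl) (S.surjective_bdPlus_incl x) (hθplus.sub hθminus)
    hvanish (a := a) (b := b) (by rwa [mfderiv_bdPlus_incl]) (by rwa [mfderiv_bdPlus_incl])
  rw [dOneForm_sub hθplus hθminus, dOneForm_pullbackOneForm S.contMDiff_incl.contMDiffAt
      (S.isDifferentiableOneFormAt_thetaPlus _),
    dOneForm_pullbackOneForm hinclF (S.isDifferentiableOneFormAt_thetaMinus _),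
    hF.mfderiv_incl_comp hx, hF.mfderiv_incl_comp hx] at hd
  exact congrArg Neg.neg (sub_eq_zero.1 hd).symm

theorem IsHolonomic.K0_le [FiniteDimensional ℝ ED] [SecondCountableTopology Q]
    (hS : S.IsHolonomic Δ) (x : D) : S.K0 Δ x ≤ (S.tIncl x).range := by
  let tIncl : ED →L[ℝ] EV := S.tIncl x
  let tMinus : EV →L[ℝ] EQ := S.tMinus (S.incl x)
  let tPlus : EV →L[ℝ] EQ := S.tPlus (S.incl x)
  exact comap_inf_comap_le_range (A := tMinus.toLinearMap) (B := tPlus.toLinearMap)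
    (i := tIncl.toLinearMap) (W₁ := Δ (S.bdMinus (S.incl x))) (W₂ := Δ (S.bdPlus (S.incl x)))
    (S.injective_incl x) ((inf_comm _ _).trans (S.ker_inf_ker (S.incl x))) (hS.finrank_eq _)
    fun w hw ↦ hS.tPlus_mem (x := x) (w := w) hw

end DCLS

end Systems

end DiscreteMechanics

end

theorem mainTheorem8_general
    {EQ : Type*} [NormedAddCommGroup EQ] [NormedSpace ℝ EQ] [FiniteDimensional ℝ EQ]
    {Q : Type*} [TopologicalSpace Q] [SecondCountableTopology Q]
    [ChartedSpace EQ Q] [IsManifold 𝓘(ℝ, EQ) ∞ Q]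
    {EV : Type*} [NormedAddCommGroup EV] [NormedSpace ℝ EV] [FiniteDimensional ℝ EV]
    {V : Type*} [TopologicalSpace V] [ChartedSpace EV V] [IsManifold 𝓘(ℝ, EV) ∞ V]
    {ED : Type*} [NormedAddCommGroup ED] [NormedSpace ℝ ED] [FiniteDimensional ℝ ED]
    {D : Type*} [TopologicalSpace D] [ChartedSpace ED D] [IsManifold 𝓘(ℝ, ED) ∞ D]
    (S : DiscreteMechanics.DCLS EQ Q EV V ED D) (Δ : ∀ q : Q, Submodule ℝ (TangentSpace 𝓘(ℝ, EQ) q))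
    (hS : S.IsHolonomic Δ) (F : D → D) (U U' : Set D) (hF : S.IsEvolutionMap F U U') :
    (∀ v δv δw, S.omegaPlus v δv δw = S.omegaMinus v δv δw) ∧
    (∀ x, S.K0 Δ x ≤ (S.tIncl x).range) ∧
    (∀ x ∈ U, ∀ δx : TangentSpace 𝓘(ℝ, ED) x, S.tIncl x δx ∈ S.K0 Δ x →
      S.tIncl (F x) (mfderiv 𝓘(ℝ, ED) 𝓘(ℝ, ED) F x δx) ∈ S.K0 Δ (F x)) ∧
    (∀ x ∈ U, ∀ δx δy : TangentSpace 𝓘(ℝ, ED) x,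
      S.tIncl x δx ∈ S.K0 Δ x → S.tIncl x δy ∈ S.K0 Δ x →
      S.omegaPlus (S.incl (F x))
        (S.tIncl (F x) (mfderiv 𝓘(ℝ, ED) 𝓘(ℝ, ED) F x δx))
        (S.tIncl (F x) (mfderiv 𝓘(ℝ, ED) 𝓘(ℝ, ED) F x δy)) =
      S.omegaPlus (S.incl x) (S.tIncl x δx) (S.tIncl x δy)) := by
  refine ⟨S.omegaPlus_eq_omegaMinus hS.closed_sigma, hS.K0_le,
    fun x hx δx hδx ↦ hF.mfderiv_mem_K0 hS hx hδx, fun x hx δx δy hδx hδy ↦ ?_⟩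
  rw [S.omegaPlus_eq_omegaMinus hS.closed_sigma (S.incl (F x))]
  exact hF.omegaMinus_eq_omegaPlus hS hx hδx.2 hδy.2

theorem mainTheorem8
    {EQ : Type*} [NormedAddCommGroup EQ] [NormedSpace ℝ EQ] [FiniteDimensional ℝ EQ]
    {Q : Type*} [TopologicalSpace Q] [T2Space Q] [SecondCountableTopology Q]
    [ChartedSpace EQ Q] [IsManifold 𝓘(ℝ, EQ) ∞ Q]
    {EV : Type*} [NormedAddCommGroup EV] [NormedSpace ℝ EV] [FiniteDimensional ℝ EV]
    {V : Type*} [TopologicalSpace V] [T2Space V] [SecondCountableTopology V]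
    [ChartedSpace EV V] [IsManifold 𝓘(ℝ, EV) ∞ V]
    {ED : Type*} [NormedAddCommGroup ED] [NormedSpace ℝ ED] [FiniteDimensional ℝ ED]
    {D : Type*} [TopologicalSpace D] [ChartedSpace ED D] [IsManifold 𝓘(ℝ, ED) ∞ D]
    (S : DiscreteMechanics.DCLS EQ Q EV V ED D) (Δ : ∀ q : Q, Submodule ℝ (TangentSpace 𝓘(ℝ, EQ) q))
    (hS : S.IsHolonomic Δ) (F : D → D) (U U' : Set D) (hF : S.IsEvolutionMap F U U') :
    -- the two forms `ω⁺` and `ω⁻` are equal; their common value is `ω`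
    (∀ v δv δw, S.omegaPlus v δv δw = S.omegaMinus v δv δw) ∧
    -- `K⁰` consists of vectors tangent to the constraint submanifold
    (∀ x, S.K0 Δ x ≤ (S.tIncl x).range) ∧
    -- `K⁰` is `TF` invariant
    (∀ x ∈ U, ∀ δx : TangentSpace 𝓘(ℝ, ED) x, S.tIncl x δx ∈ S.K0 Δ x →
      S.tIncl (F x) (mfderiv 𝓘(ℝ, ED) 𝓘(ℝ, ED) F x δx) ∈ S.K0 Δ (F x)) ∧
    -- `F` preserves `ω` on `K⁰`
    (∀ x ∈ U, ∀ δx δy : TangentSpace 𝓘(ℝ, ED) x,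
      S.tIncl x δx ∈ S.K0 Δ x → S.tIncl x δy ∈ S.K0 Δ x →
      S.omegaPlus (S.incl (F x))
        (S.tIncl (F x) (mfderiv 𝓘(ℝ, ED) 𝓘(ℝ, ED) F x δx))
        (S.tIncl (F x) (mfderiv 𝓘(ℝ, ED) 𝓘(ℝ, ED) F x δy)) =
      S.omegaPlus (S.incl x) (S.tIncl x δx) (S.tIncl x δy)) :=
  mainTheorem8_general S Δ hS F U U' hF
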